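/- Let $M$ be a compact smooth manifold (without boundary) of dimension $m$ with a smooth Riemannian metric $g$, and let $N\subset M$ be a compact embedded smooth submanifold of dimension $n$ with $m\ge n+2$. Let $\tilde g$ be a smooth Riemannian metric on $M\setminus N$ and let $f\in C^\infty(M\setminus N)$ be real valued. Assume that near every point of $N$ there are smooth local coordinates $(x,y)=(x_1,\dots,x_{m-n},y_1,\dots,y_n)$ of $M$ in which $N$ is given by $x=0$, the metric $g$ is block-diagonal, and $\tilde g$ arises from it by multiplying the $x$-block by $f^2$: \[ g=\begin{pmatrix} g_1&0\\0&g_2\end{pmatrix},\qquad \tilde g=\begin{pmatrix} f^2g_1&0\\0&g_2\end{pmatrix}\ \text{ off } N, \] where $g_1$ and $g_2$ are matrix-valued functions of sizes $(m-n)\times(m-n)$ and $n\times n$. If $m=2$, assume that $f\in L^{2+\epsilon}_g(M)$ for some $\epsilon>0$. If $m\ge 3$, assume that $\inf_{M\setminus N} f>0$ and that $f\in L_g^{m(m-n)/2+\epsilon}(M)$ for some $\epsilon>0$. Let $W^{1,2}_{\tilde g}(M\setminus N)$ be the space of all $u\in L^2_{\tilde g}(M\setminus N)$ that have a weak gradient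 $\tilde\nabla u$ on $M\setminus N$ with $|\tilde\nabla u|_{\tilde g}\in L^2_{\tilde g}(M\setminus N)$, with the norm $\bigl(\int u^2\,d\tilde A+\int|\tilde\nabla u|_{\tilde g}^2\,d\tilde A\bigr)^{1/2}$, where $d\tilde A$ is the Riemannian measure of $\tilde g$. Then $W^{1,2}_{\tilde g}(M\setminus N)$ is compactly included in $L^2_{\tilde g}(M\setminus N)$, that is, every subset of $W^{1,2}_{\tilde g}(M\setminus N)$ that is bounded in its norm is relatively compact in $L^2_{\tilde g}(M\setminus N)$. -/

import Mathlib

open Set Filter Topology MeasureTheory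
open scoped Manifold ContDiff ENNReal NNReal

noncomputable section

/-- The model space `ℝᵐ`. -/
abbrev Rm (m : ℕ) : Type := EuclideanSpace ℝ (Fin m)

/-- Smooth Riemannian metrics on a smooth `m`-manifold `X` without boundary. -/
abbrev SmoothMetric (m : ℕ) (X : Type*) [TopologicalSpace X] [ChartedSpace (Rm m) X]
    [IsManifold (𝓡 m) ∞ X] : Type _ :=
  Bundle.ContMDiffRiemannianMetric (𝓡 m) ∞ (Rm m) (fun x : X => TangentSpace (𝓡 m) x)

/-- The complement of a compact subset of a Hausdorff space, as an open subset (and so, for a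
subset of a manifold, as an open submanifold). -/
def complOpens {M : Type*} [TopologicalSpace M] [T2Space M] {N : Set M} (hN : IsCompact N) :
    TopologicalSpace.Opens M :=
  ⟨Nᶜ, hN.isClosed.isOpen_compl⟩

section Riemannian

variable {m : ℕ} {X : Type*} [TopologicalSpace X] [ChartedSpace (Rm m) X]
  [IsManifold (𝓡 m) ∞ X]

/-- The `i`-th coordinate vector `∂ᵢ` of the chart `φ`, at the point with coordinates `y`. -/
def coordVec (φ : OpenPartialHomeomorph X (Rm m)) (y : Rm m) (i : Fin m) :
    TangentSpace (𝓡 m) (φ.symm y) :=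
  mfderiv (𝓡 m) (𝓡 m) φ.symm y (EuclideanSpace.single i (1 : ℝ) : Rm m)

/-- The matrix `(h(∂ᵢ, ∂ⱼ))` of the metric `h` in the chart `φ`, at the point with
coordinates `y`. -/
def gram (h : SmoothMetric m X) (φ : OpenPartialHomeomorph X (Rm m)) (y : Rm m) :
    Matrix (Fin m) (Fin m) ℝ :=
  Matrix.of fun i j => h.inner (φ.symm y) (coordVec φ y i) (coordVec φ y j)

variable [MeasurableSpace X]

/-- The Riemannian measure on the domain of the chart `φ`: the image of `√(det h) dy`
under `φ⁻¹`. -/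
def chartVolume (h : SmoothMetric m X) (φ : OpenPartialHomeomorph X (Rm m)) : Measure X :=
  (((volume : Measure (Rm m)).restrict φ.target).withDensity
    fun y => ENNReal.ofReal (Real.sqrt (gram h φ y).det)).map φ.symm

/-- The Riemannian measure of `(X, h)`. By the change of variables formula the measures
`chartVolume h φ` agree on the overlaps of the chart domains; on a second countable manifold their
least upper bound is therefore the unique measure that restricts to `chartVolume h φ` on the domain
of every smooth chart `φ`. -/
def riemVolume (h : SmoothMetric m X) : Measure X :=
  ⨆ φ ∈ IsManifold.maximalAtlas (𝓡 m) ∞ X, chartVolume h φ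

/-- `Z` is a weak gradient of `u` with respect to `h`: in every smooth chart, `u` and the functions
`h(Z, ∂ᵢ)` are locally integrable, and `h(Z, ∂ᵢ)` is the `i`-th distributional partial derivative
of `u`. -/
def IsWeakGradient (h : SmoothMetric m X) (u : X → ℝ) (Z : ∀ q : X, TangentSpace (𝓡 m) q) :
    Prop :=
  ∀ φ ∈ IsManifold.maximalAtlas (𝓡 m) ∞ X,
    LocallyIntegrableOn (fun y => u (φ.symm y)) φ.target volume ∧
    ∀ i : Fin m,
      LocallyIntegrableOn (fun y => h.inner (φ.symm y) (Z (φ.symm y)) (coordVec φ y i))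
        φ.target volume ∧
      ∀ ψ : Rm m → ℝ, ContDiff ℝ ∞ ψ → HasCompactSupport ψ → tsupport ψ ⊆ φ.target →
        ∫ y in φ.target, u (φ.symm y) * fderiv ℝ ψ y (EuclideanSpace.single i (1 : ℝ)) =
          -∫ y in φ.target, h.inner (φ.symm y) (Z (φ.symm y)) (coordVec φ y i) * ψ y

/-- The norm `(∫ u² + ∫ |∇u|²)^{1/2}` of `W^{1,2}_h(X)`, with value `∞` if `u` has no
square integrable weak gradient. (The weak gradient is unique almost everywhere, so that the infimum
has at most one value to choose from.) -/
def sobolevNorm (h : SmoothMetric m X) (u : X → ℝ) : ℝ≥0∞ :=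
  ⨅ (Z : ∀ q : X, TangentSpace (𝓡 m) q) (_ : IsWeakGradient h u Z),
    ((∫⁻ q, ENNReal.ofReal (u q ^ 2) ∂riemVolume h) +
      ∫⁻ q, ENNReal.ofReal (h.inner q (Z q) (Z q)) ∂riemVolume h) ^ (1 / 2 : ℝ)

/-- The Sobolev space `W^{1,2}_h(X)`, as a subset of `L²_h(X)`. -/
def sobolevSpace (h : SmoothMetric m X) : Set (Lp ℝ 2 (riemVolume h)) :=
  {u | sobolevNorm h u < ⊤}

/-- `W^{1,2}_h(X)` is compactly included in `L²_h(X)`: its norm-bounded subsets are relatively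
compact in `L²_h(X)`. -/
def SobolevCompactlyIncluded (h : SmoothMetric m X) : Prop :=
  ∀ S ⊆ sobolevSpace h, (∃ C : ℝ≥0, ∀ u ∈ S, sobolevNorm h u ≤ C) → IsCompact (closure S)

end Riemannian

section Coordinates

variable {m : ℕ}

/-- The index in `Fin m` of the coordinate `xᵢ`, for coordinates `(x₁, …, x_{m-n}, y₁, …, y_n)`. -/
def xIdx (m n : ℕ) (i : Fin (m - n)) : Fin m := Fin.castLE (Nat.sub_le m n) i

/-- The index in `Fin m` of the coordinate `yⱼ`, for coordinates `(x₁, …, x_{m-n}, y₁, …, y_n)`. -/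
def yIdx {m n : ℕ} (hnm : n ≤ m) (j : Fin n) : Fin m :=
  Fin.cast (Nat.sub_add_cancel hnm) (Fin.natAdd (m - n) j)

/-- The value `dκᵢ(v)` at the tangent vector `v` of the differential of the `i`-th component
of `κ : X → ℝᵐ`. -/
def dcoord {X : Type*} [TopologicalSpace X] [ChartedSpace (Rm m) X]
    (κ : X → Rm m) (i : Fin m) (q : X) (v : TangentSpace (𝓡 m) q) : ℝ :=
  (show Rm m from mfderiv (𝓡 m) (𝓡 m) κ q v) i

/-- The bilinear form `∑ Aᵢⱼ dxᵢ dxⱼ + ∑ Bᵢⱼ dyᵢ dyⱼ`, that is, the form with the block matrix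
`diag(A, B)` in the coordinates `κ = (x, y)`. -/
def blockForm {X : Type*} [TopologicalSpace X] [ChartedSpace (Rm m) X] {n : ℕ} (hnm : n ≤ m)
    (κ : X → Rm m) (A : Matrix (Fin (m - n)) (Fin (m - n)) ℝ) (B : Matrix (Fin n) (Fin n) ℝ)
    (q : X) (v w : TangentSpace (𝓡 m) q) : ℝ :=
  (∑ i, ∑ j, A i j * dcoord κ (xIdx m n i) q v * dcoord κ (xIdx m n j) q w) +
    ∑ i, ∑ j, B i j * dcoord κ (yIdx hnm i) q v * dcoord κ (yIdx hnm j) q w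

/-- `φ` is a smooth chart of `M` with coordinates `(x, y)` in which `N` is given by `x = 0`. -/
def IsSliceChart {M : Type*} [TopologicalSpace M] [ChartedSpace (Rm m) M] (n : ℕ)
    (N : Set M) (φ : OpenPartialHomeomorph M (Rm m)) : Prop :=
  φ ∈ IsManifold.maximalAtlas (𝓡 m) ∞ M ∧
    ∀ q ∈ φ.source, q ∈ N ↔ ∀ i : Fin (m - n), φ q (xIdx m n i) = 0

/-- `N` is an `n`-dimensional (embedded, smooth) submanifold of the `m`-manifold `M`. -/
def IsSubmanifold {M : Type*} [TopologicalSpace M] [ChartedSpace (Rm m) M] (n : ℕ)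
    (N : Set M) : Prop :=
  n ≤ m ∧ ∀ p ∈ N, ∃ φ : OpenPartialHomeomorph M (Rm m), p ∈ φ.source ∧ IsSliceChart n N φ

end Coordinates

end

/-! The proof bounds how far a Sobolev function is from being constant on small cubes, and so
approximates a bounded set uniformly in L² by a finite-dimensional space of step functions. No
embedding theorem and no extension across N are needed.

In a slice chart the Gram matrix of the second metric is that of g with the x-coordinate vectors
rescaled by f. Its volume density is therefore w = |f|^(m-n) √(det g), and two facts enter. First,
the integrability of f puts w locally in L^q with q > 1 and q > m/2. Second, by Cauchy–Schwarz the
Euclidean energy density of u is at most |∇u|² times the trace of the Gram matrix, and this trace is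
at most C w: for m ≥ 3 because f is bounded below and m - n ≥ 2, for m = 2 because then n = 0 and f²
= |f|^(m-n). So the Euclidean Dirichlet integral is controlled by the Riemannian one.

The analytic core is `exists_lintegral_lintegral_sq_sub_le`, a Poincaré inequality on a convex set P
of diameter at most d for the measure w dx. It integrates |v(x) - v(z)|² along segments, substitutes
y = x + t(z - x), and bounds the integral of w over a ball of radius t d by Hölder; q > m/2 makes
the remaining integral over t converge. On a cube of side ℓ this gives a constant c with ∫ (v - c)²
w ≤ C ℓ^(2 - m/q) ‖w‖_q ∫ |∇v|², and the factor tends to 0 with ℓ.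

The submanifold enters only through the segments: as its codimension is at least 2, almost every
segment misses it (`ae_ae_segment_ne_zero`). Hence the weak derivative off N suffices, by the
identity `HasWeakPartials.ae_sub_eq_integral` along almost every segment in the domain.

Finally M is compact, so finitely many balls of this kind cover M \ N (`IsAdmissibleBall`), and
`sobolevCompactlyIncluded_of_admissibleBalls` assembles the step functions. -/

/-! ### Averages of test functions over segments. -/

section LineAverage

variable {E : Type} [NormedAddCommGroup E] [NormedSpace ℝ E]

/-- The average of `ψ` over the segment from `y - e` to `y`. -/
noncomputable def segmentAverage {F : Type} [NormedAddCommGroup F] [NormedSpace ℝ F]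
    (ψ : E → F) (e y : E) : F :=
  ∫ t in (0 : ℝ)..1, ψ (y - t • e)

theorem hasFDerivAt_segmentAverage {F : Type} [NormedAddCommGroup F] [NormedSpace ℝ F]
    {ψ : E → F} (hψ : ContDiff ℝ ∞ ψ) (hc : HasCompactSupport ψ) (e y : E) :
    HasFDerivAt (segmentAverage ψ e) (segmentAverage (fderiv ℝ ψ) e y) y := by
  have hd : Continuous (fderiv ℝ ψ) := hψ.continuous_fderiv (by simp)
  obtain ⟨C, hC⟩ := (hc.fderiv ℝ).exists_bound_of_continuous hd
  refine (intervalIntegral.hasFDerivAt_integral_of_dominated_of_fderiv_le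
    (F := fun y t => ψ (y - t • e)) (F' := fun y t => fderiv ℝ ψ (y - t • e))
    (bound := fun _ => C) (s := univ) univ_mem ?_ ?_ ?_ ?_ ?_ ?_)
  · exact Eventually.of_forall fun z => (hψ.continuous.comp (by fun_prop)).aestronglyMeasurable
  · exact (hψ.continuous.comp (by fun_prop)).intervalIntegrable _ _
  · exact (hd.comp (by fun_prop)).aestronglyMeasurable
  · exact Eventually.of_forall fun t _ z _ => hC _
  · exact intervalIntegrable_const
  · refine Eventually.of_forall fun t _ z _ => ?_
    have h1 : HasFDerivAt ψ (fderiv ℝ ψ (z - t • e)) (z - t • e) :=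
      (hψ.differentiable (by simp) _).hasFDerivAt
    simpa [Function.comp_def] using h1.comp z ((hasFDerivAt_id z).sub_const (t • e))

/-- The derivative of an average is the average of the derivative, so smoothness follows by
induction on the order; the codomain varies because the derivative takes values in another space. -/
theorem contDiff_segmentAverage {F : Type} [NormedAddCommGroup F] [NormedSpace ℝ F]
    {ψ : E → F} (hψ : ContDiff ℝ ∞ ψ) (hc : HasCompactSupport ψ) (e : E) :
    ContDiff ℝ ∞ (segmentAverage ψ e) := by
  rw [contDiff_infty]
  intro n
  induction n generalizing F with
  | zero =>
    refine contDiff_zero.2 (continuous_iff_continuousAt.2 fun y =>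
      (hasFDerivAt_segmentAverage hψ hc e y).continuousAt)
  | succ n ih =>
    have h : fderiv ℝ (segmentAverage ψ e) = segmentAverage (fderiv ℝ ψ) e :=
      funext fun y => (hasFDerivAt_segmentAverage hψ hc e y).fderiv
    refine (contDiff_succ_iff_fderiv (n := n)).2 ⟨fun y =>
      (hasFDerivAt_segmentAverage hψ hc e y).differentiableAt, by simp, ?_⟩
    rw [h]
    exact ih (hψ.fderiv_right (by simp)) (hc.fderiv ℝ)

/-- In the direction of the segment the integrand is an exact t-derivative. Tested against this
average, a weak derivative along e becomes a finite difference. -/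
theorem fderiv_segmentAverage_apply {ψ : E → ℝ} (hψ : ContDiff ℝ ∞ ψ) (hc : HasCompactSupport ψ)
    (e y : E) : fderiv ℝ (segmentAverage ψ e) y e = ψ y - ψ (y - e) := by
  rw [(hasFDerivAt_segmentAverage hψ hc e y).fderiv]
  have hd : Continuous (fderiv ℝ ψ) := hψ.continuous_fderiv (by simp)
  have h1 : segmentAverage (fderiv ℝ ψ) e y e
      = ∫ t in (0 : ℝ)..1, fderiv ℝ ψ (y - t • e) e := by
    unfold segmentAverage
    exact ContinuousLinearMap.intervalIntegral_apply
      ((hd.comp (by fun_prop)).intervalIntegrable _ _) e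
  have h2 : ∀ t ∈ uIcc (0 : ℝ) 1,
      HasDerivAt (fun t : ℝ => -ψ (y - t • e)) (fderiv ℝ ψ (y - t • e) e) t := by
    intro t _
    have h3 : HasFDerivAt ψ (fderiv ℝ ψ (y - t • e)) (y - t • e) :=
      (hψ.differentiable (by simp) _).hasFDerivAt
    have h4 : HasDerivAt (fun t : ℝ => y - t • e) (-e) t := by
      simpa using ((hasDerivAt_id t).smul_const e).const_sub y
    have h5 := (h3.comp_hasDerivAt t h4).fun_neg
    simp only [map_neg, neg_neg] at h5
    exact h5
  rw [h1, intervalIntegral.integral_eq_sub_of_hasDerivAt h2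
    (Continuous.intervalIntegrable (by fun_prop) _ _)]
  simp; ring

/-- The union of the segments from `x` to `x + e`, for `x ∈ K`. -/
def sweep (K : Set E) (e : E) : Set E := (fun p : E × ℝ => p.1 + p.2 • e) '' (K ×ˢ Icc (0 : ℝ) 1)

theorem isCompact_sweep {K : Set E} (hK : IsCompact K) (e : E) : IsCompact (sweep K e) :=
  (hK.prod isCompact_Icc).image (by fun_prop)

theorem add_smul_mem_sweep {K : Set E} {x : E} (hx : x ∈ K) {t : ℝ} (ht : t ∈ Icc (0 : ℝ) 1)
    (e : E) : x + t • e ∈ sweep K e := ⟨(x, t), ⟨hx, ht⟩, rfl⟩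

theorem segmentAverage_eq_zero {ψ : E → ℝ} {e y : E} (hy : y ∉ sweep (tsupport ψ) e) :
    segmentAverage ψ e y = 0 := by
  unfold segmentAverage
  rw [intervalIntegral.integral_zero_ae]
  refine Eventually.of_forall fun t ht => ?_
  by_contra h
  rw [uIoc_of_le zero_le_one] at ht
  refine hy ?_
  have := add_smul_mem_sweep (subset_tsupport ψ h) (Ioc_subset_Icc_self ht) e
  simpa using this

theorem tsupport_segmentAverage_subset {ψ : E → ℝ} (hc : HasCompactSupport ψ) (e : E) :
    tsupport (segmentAverage ψ e) ⊆ sweep (tsupport ψ) e := by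
  refine closure_minimal (fun y hy => ?_) (isCompact_sweep hc e).isClosed
  by_contra h
  exact hy (segmentAverage_eq_zero h)

end LineAverage

/-! ### Weak derivatives and the fundamental theorem along almost every segment. -/

section LineIdentity

theorem MeasureTheory.Integrable.comp_add_smul {E : Type} [NormedAddCommGroup E] [NormedSpace ℝ E]
    [MeasurableSpace E] [BorelSpace E] [FiniteDimensional ℝ E] {μ : Measure E} [μ.IsAddHaarMeasure]
    {D : E → ℝ} (hD : Integrable D μ) (e : E) :
    Integrable (fun p : ℝ × E => D (p.2 + p.1 • e))
      ((volume.restrict (Ioc (0 : ℝ) 1)).prod μ) := by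
  have hT : MeasurePreserving (fun p : ℝ × E => (p.1, p.2 + p.1 • e))
      ((volume.restrict (Ioc (0 : ℝ) 1)).prod μ) ((volume.restrict (Ioc (0 : ℝ) 1)).prod μ) := by
    refine (MeasurePreserving.id _).skew_product (g := fun t x => x + t • e) (by fun_prop) ?_
    exact Eventually.of_forall fun t => (measurePreserving_add_right μ (t • e)).map_eq
  have h : Integrable (fun p : ℝ × E => D p.2) ((volume.restrict (Ioc (0 : ℝ) 1)).prod μ) :=
    hD.comp_snd _
  exact hT.integrable_comp_of_integrable h

/-- Forward averaging of D is adjoint to backward averaging of ψ, by Fubini and translation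
invariance. -/
theorem integral_mul_integral_add_smul {E : Type} [NormedAddCommGroup E] [NormedSpace ℝ E]
    [MeasurableSpace E] [BorelSpace E] [FiniteDimensional ℝ E] {μ : Measure E} [μ.IsAddHaarMeasure]
    {D ψ : E → ℝ} (hD : Integrable D μ) (hψ : Continuous ψ) (hc : HasCompactSupport ψ) (e : E) :
    ∫ x, ψ x * (∫ t in (0 : ℝ)..1, D (x + t • e)) ∂μ = ∫ y, D y * segmentAverage ψ e y ∂μ := by
  obtain ⟨C, hC⟩ := hc.exists_bound_of_continuous hψ
  have h1 : Integrable (fun p : ℝ × E => ψ p.2 * D (p.2 + p.1 • e))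
      ((volume.restrict (Ioc (0 : ℝ) 1)).prod μ) :=
    (hD.comp_add_smul e).bdd_mul (c := C) (by fun_prop) (Eventually.of_forall fun p => hC _)
  have h2 : Integrable (fun p : ℝ × E => ψ (p.2 - p.1 • e) * D p.2)
      ((volume.restrict (Ioc (0 : ℝ) 1)).prod μ) :=
    (hD.comp_snd _).bdd_mul (c := C)
      ((hψ.comp (by fun_prop)).aestronglyMeasurable) (Eventually.of_forall fun p => hC _)
  calc ∫ x, ψ x * (∫ t in (0 : ℝ)..1, D (x + t • e)) ∂μ
      = ∫ x, (∫ t in Ioc (0 : ℝ) 1, ψ x * D (x + t • e)) ∂μ := by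
        simp_rw [intervalIntegral.integral_of_le zero_le_one, integral_const_mul]
    _ = ∫ t in Ioc (0 : ℝ) 1, ∫ x, ψ x * D (x + t • e) ∂μ :=
        (integral_integral_swap h1).symm
    _ = ∫ t in Ioc (0 : ℝ) 1, ∫ y, ψ (y - t • e) * D y ∂μ := by
        refine integral_congr_ae (Eventually.of_forall fun t => ?_)
        simpa using
          integral_add_right_eq_self (μ := μ) (fun y => ψ (y - t • e) * D y) (t • e)
    _ = ∫ y, (∫ t in Ioc (0 : ℝ) 1, ψ (y - t • e) * D y) ∂μ := integral_integral_swap h2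
    _ = ∫ y, D y * segmentAverage ψ e y ∂μ := by
        unfold segmentAverage
        simp_rw [intervalIntegral.integral_of_le zero_le_one, integral_mul_const, mul_comm]

variable {m : ℕ}

/-- The functions `G i` are the distributional partial derivatives of `v` on the open set `U`. -/
def HasWeakPartials (U : Set (Rm m)) (v : Rm m → ℝ) (G : Fin m → Rm m → ℝ) : Prop :=
  LocallyIntegrableOn v U volume ∧ ∀ i : Fin m, LocallyIntegrableOn (G i) U volume ∧
    ∀ ψ : Rm m → ℝ, ContDiff ℝ ∞ ψ → HasCompactSupport ψ → tsupport ψ ⊆ U →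
      ∫ y in U, v y * fderiv ℝ ψ y (EuclideanSpace.single i (1 : ℝ)) = -∫ y in U, G i y * ψ y

theorem MeasureTheory.LocallyIntegrableOn.integrableOn_mul_of_tsupport_subset {U : Set (Rm m)}
    {v k : Rm m → ℝ}
    (hv : LocallyIntegrableOn v U volume) (hk : Continuous k) (hc : HasCompactSupport k)
    (hU : tsupport k ⊆ U) : IntegrableOn (fun y => v y * k y) U volume := by
  refine Integrable.integrableOn ?_
  have h1 := (hv.integrableOn_compact_subset hU hc).mul_continuousOn hk.continuousOn hc
  refine (integrableOn_iff_integrable_of_support_subset ?_).1 h1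
  intro y hy
  exact subset_tsupport k (right_ne_zero_of_mul hy)

theorem HasWeakPartials.integral_mul_fderiv {U : Set (Rm m)} {v : Rm m → ℝ}
    {G : Fin m → Rm m → ℝ} (h : HasWeakPartials U v G) (e : Rm m) {ψ : Rm m → ℝ}
    (hψ : ContDiff ℝ ∞ ψ) (hc : HasCompactSupport ψ) (hU : tsupport ψ ⊆ U) :
    ∫ y in U, v y * fderiv ℝ ψ y e = -∫ y in U, (∑ i, e i * G i y) * ψ y := by
  have he : e = ∑ i, e i • (EuclideanSpace.single i (1 : ℝ) : Rm m) := by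
    ext j
    simp [Finset.sum_apply, Pi.single_apply]
  have h1 : ∀ y, v y * fderiv ℝ ψ y e
      = ∑ i, e i * (v y * fderiv ℝ ψ y (EuclideanSpace.single i (1 : ℝ))) := by
    intro y
    conv_lhs => rw [he]
    rw [map_sum, Finset.mul_sum]
    refine Finset.sum_congr rfl fun i _ => ?_
    rw [map_smul, smul_eq_mul]; ring
  have h2 : ∀ y, (∑ i, e i * G i y) * ψ y = ∑ i, e i * (G i y * ψ y) := by
    intro y
    rw [Finset.sum_mul]
    exact Finset.sum_congr rfl fun i _ => by ring
  have hd : Continuous (fderiv ℝ ψ) := hψ.continuous_fderiv (by simp)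
  have i1 : ∀ i : Fin m, IntegrableOn
      (fun y => v y * fderiv ℝ ψ y (EuclideanSpace.single i (1 : ℝ))) U volume := by
    intro i
    refine h.1.integrableOn_mul_of_tsupport_subset (by fun_prop) ?_ ?_
    · exact (hc.fderiv_apply ℝ _)
    · exact (tsupport_fderiv_apply_subset ℝ _).trans hU
  have i2 : ∀ i : Fin m, IntegrableOn (fun y => G i y * ψ y) U volume := fun i =>
    (h.2 i).1.integrableOn_mul_of_tsupport_subset hψ.continuous hc hU
  simp_rw [h1, h2]
  rw [integral_finsetSum _ fun i _ => (i1 i).const_mul _,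
    integral_finsetSum _ fun i _ => (i2 i).const_mul _, ← Finset.sum_neg_distrib]
  refine Finset.sum_congr rfl fun i _ => ?_
  rw [integral_const_mul, integral_const_mul, (h.2 i).2 ψ hψ hc hU, mul_neg]

/-- A function with weak partial derivatives is, for almost every segment in the direction `e`,
the integral of its directional derivative. -/
theorem HasWeakPartials.ae_sub_eq_integral {U : Set (Rm m)} (hU : IsOpen U) {v : Rm m → ℝ}
    {G : Fin m → Rm m → ℝ} (h : HasWeakPartials U v G) (e : Rm m) :
    ∀ᵐ x, (∀ t ∈ Icc (0 : ℝ) 1, x + t • e ∈ U) →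
      v (x + e) - v x = ∫ t in (0 : ℝ)..1, ∑ i, e i * G i (x + t • e) := by
  set D : Rm m → ℝ := fun y => ∑ i, e i * G i y with hDdef
  -- V is open, and the average of a test function supported in V is a test function supported in U.
  -- So it is enough to show that the difference of the two sides annihilates all test functions on
  -- V.
  set V : Set (Rm m) := {x | ∀ t ∈ Icc (0 : ℝ) 1, x + t • e ∈ U} with hVdef
  have hV : IsOpen V := by
    rw [isOpen_iff_mem_nhds]
    intro x hx
    have : ∀ᶠ y in 𝓝 x, ∀ t ∈ Icc (0 : ℝ) 1, y + t • e ∈ U := by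
      refine isCompact_Icc.eventually_forall_of_forall_eventually fun t ht => ?_
      have hcont : Continuous fun z : Rm m × ℝ => z.1 + z.2 • e := by fun_prop
      exact hcont.continuousAt.preimage_mem_nhds (hU.mem_nhds (hx t ht))
    exact this
  have hsw : ∀ K ⊆ V, sweep K e ⊆ U := by
    rintro K hK _ ⟨⟨x, t⟩, ⟨hx, ht⟩, rfl⟩
    exact hK hx t ht
  have hDloc : LocallyIntegrableOn D U volume := by
    rw [locallyIntegrableOn_iff hU.isLocallyClosed]
    intro K hKU hK
    exact integrable_finsetSum _ fun i _ =>
      ((h.2 i).1.integrableOn_compact_subset hKU hK).const_mul _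
  have key : ∀ᵐ x, x ∈ V →
      v (x + e) - v x - (∫ t in (0 : ℝ)..1, D (x + t • e)) = 0 := by
    refine hV.ae_eq_zero_of_integral_contDiff_smul_eq_zero
      (f := fun x => v (x + e) - v x - (∫ t in (0 : ℝ)..1, D (x + t • e))) ?_ ?_
    · rw [locallyIntegrableOn_iff hV.isLocallyClosed]
      intro K hKV hK
      have hKc := isCompact_sweep hK e
      have hv1 : Integrable ((sweep K e).indicator v) volume :=
        (h.1.integrableOn_compact_subset (hsw K hKV) hKc).integrable_indicator hKc.measurableSet
      have hD1 : Integrable ((sweep K e).indicator D) volume :=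
        (hDloc.integrableOn_compact_subset (hsw K hKV) hKc).integrable_indicator hKc.measurableSet
      have hI : Integrable (fun x => ∫ t in Ioc (0 : ℝ) 1, (sweep K e).indicator D (x + t • e))
          volume := (hD1.comp_add_smul e).integral_prod_right
      have hall := (((hv1.comp_add_right e).sub hv1).sub hI).integrableOn (s := K)
      refine hall.congr_fun (fun x hx => ?_) hK.measurableSet
      have m1 : x + e ∈ sweep K e := by
        simpa using add_smul_mem_sweep hx (t := 1) (by simp) e
      have m0 : x ∈ sweep K e := by
        simpa using add_smul_mem_sweep hx (t := 0) (by simp) e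
      simp only [Pi.sub_apply, indicator_of_mem m1, indicator_of_mem m0]
      congr 1
      rw [intervalIntegral.integral_of_le zero_le_one]
      refine setIntegral_congr_fun measurableSet_Ioc fun t ht => ?_
      exact indicator_of_mem (add_smul_mem_sweep hx (Ioc_subset_Icc_self ht) e) _
    · intro ψ hψ hc hψV
      set K := tsupport ψ with hKdef
      have hKc := isCompact_sweep (K := K) hc e
      have hKU := hsw K hψV
      -- Only local integrability on U is known. Cutting off to the compact swept set, which
      -- contains every point that matters for ψ, gives integrable functions on the whole space,
      -- where translations are available.
      set v' := (sweep K e).indicator v with hv'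
      set D' := (sweep K e).indicator D with hD'
      have hv1 : Integrable v' volume :=
        (h.1.integrableOn_compact_subset hKU hKc).integrable_indicator hKc.measurableSet
      have hD1 : Integrable D' volume :=
        (hDloc.integrableOn_compact_subset hKU hKc).integrable_indicator hKc.measurableSet
      obtain ⟨C, hC⟩ := hc.exists_bound_of_continuous hψ.continuous
      have hI : Integrable (fun x => ∫ t in (0 : ℝ)..1, D' (x + t • e)) volume := by
        simp_rw [intervalIntegral.integral_of_le zero_le_one]
        exact (hD1.comp_add_smul e).integral_prod_right
      have hbd : ∀ {k : Rm m → ℝ}, Integrable k volume →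
          Integrable (fun x => ψ x * k x) volume := fun hk =>
        hk.bdd_mul (c := C) hψ.continuous.aestronglyMeasurable (Eventually.of_forall hC)
      have e1 : ∀ x, ψ x • (v (x + e) - v x - (∫ t in (0 : ℝ)..1, D (x + t • e)))
          = ψ x * v' (x + e) - ψ x * v' x - ψ x * ∫ t in (0 : ℝ)..1, D' (x + t • e) := by
        intro x
        by_cases hx : ψ x = 0
        · simp [hx]
        have hxK : x ∈ K := subset_tsupport ψ hx
        have m1 : x + e ∈ sweep K e := by
          simpa using add_smul_mem_sweep hxK (t := 1) (by simp) e
        have m0 : x ∈ sweep K e := by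
          simpa using add_smul_mem_sweep hxK (t := 0) (by simp) e
        have : (∫ t in (0 : ℝ)..1, D' (x + t • e)) = ∫ t in (0 : ℝ)..1, D (x + t • e) := by
          refine intervalIntegral.integral_congr fun t ht => ?_
          rw [uIcc_of_le zero_le_one] at ht
          exact indicator_of_mem (add_smul_mem_sweep hxK ht e) _
        rw [this, hv', indicator_of_mem m1, indicator_of_mem m0, smul_eq_mul]
        ring
      simp_rw [e1]
      have hdiff : Integrable (fun x => ψ x * v' (x + e) - ψ x * v' x) volume :=
        (hbd (hv1.comp_add_right e)).sub (hbd hv1)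
      rw [integral_sub hdiff (hbd hI),
        integral_sub (hbd (hv1.comp_add_right e)) (hbd hv1),
        integral_mul_integral_add_smul hD1 hψ.continuous hc e]
      have hΨ := h.integral_mul_fderiv e (contDiff_segmentAverage hψ hc e)
        (hKc.of_isClosed_subset (isClosed_tsupport _) (tsupport_segmentAverage_subset hc e))
        ((tsupport_segmentAverage_subset hc e).trans hKU)
      simp_rw [fderiv_segmentAverage_apply hψ hc e] at hΨ
      have e2 : ∫ y in U, (∑ i, e i * G i y) * segmentAverage ψ e y
          = ∫ y, D' y * segmentAverage ψ e y := by
        refine Eq.trans ?_ (setIntegral_eq_integral_of_forall_compl_eq_zero (s := U) ?_)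
        · refine setIntegral_congr_fun hU.measurableSet fun y _ => ?_
          by_cases hy : y ∈ sweep K e
          · simp [hD', indicator_of_mem hy, hDdef]
          · simp [segmentAverage_eq_zero hy]
        · intro y hy
          rw [hD', indicator_of_notMem (fun h' => hy (hKU h')), zero_mul]
      have hzero : ∀ y, y ∉ sweep K e → ψ y - ψ (y - e) = 0 := by
        intro y hy
        have h0 : ψ y = 0 := by
          by_contra h'
          exact hy (by simpa using add_smul_mem_sweep (subset_tsupport ψ h') (t := 0) (by simp) e)
        have h1 : ψ (y - e) = 0 := by
          by_contra h'
          exact hy (by simpa using add_smul_mem_sweep (subset_tsupport ψ h') (t := 1) (by simp) e)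
        rw [h0, h1, sub_zero]
      have e3 : ∫ y in U, v y * (ψ y - ψ (y - e)) = ∫ y, v' y * (ψ y - ψ (y - e)) := by
        refine Eq.trans ?_ (setIntegral_eq_integral_of_forall_compl_eq_zero (s := U) ?_)
        · refine setIntegral_congr_fun hU.measurableSet fun y _ => ?_
          by_cases hy : y ∈ sweep K e
          · simp [hv', indicator_of_mem hy]
          · simp [hzero y hy]
        · intro y hy
          rw [hv', indicator_of_notMem (fun h' => hy (hKU h')), zero_mul]
      have e4 : ∫ y, v' y * (ψ y - ψ (y - e)) = ∫ y, ψ y * v' y - ψ (y - e) * v' y :=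
        integral_congr_ae (Eventually.of_forall fun y => by ring)
      have e5 : ∫ y, ψ (y - e) * v' y = ∫ x, ψ x * v' (x + e) := by
        simpa using (integral_add_right_eq_self (fun y => ψ (y - e) * v' y) e).symm
      have i5 : Integrable (fun y => ψ (y - e) * v' y) volume :=
        hv1.bdd_mul (c := C) (hψ.continuous.comp (by fun_prop)).aestronglyMeasurable
          (Eventually.of_forall fun y => hC _)
      rw [e2, e3, e4, integral_sub (hbd hv1) i5, e5] at hΨ
      linarith
  filter_upwards [key] with x hx hxV
  have := hx hxV
  linarith

end LineIdentity

/-! ### The weighted Poincaré inequality in double integral form. -/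

section WeightedPoincare

variable {m : ℕ}

theorem lintegral_homothety {F : Rm m → ℝ≥0∞} (hF : Measurable F) (x : Rm m) {t : ℝ} (ht : 0 < t) :
    ∫⁻ z, F (x + t • (z - x)) = ENNReal.ofReal ((t ^ m)⁻¹) * ∫⁻ y, F y := by
  have h1 : Measurable fun y => F (x + y) := hF.comp (by fun_prop)
  calc ∫⁻ z, F (x + t • (z - x)) = ∫⁻ z, F (x + t • z) :=
        lintegral_sub_right_eq_self (fun z => F (x + t • z)) x
    _ = ∫⁻ y, F (x + y) ∂(Measure.map (fun z : Rm m => t • z) volume) := by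
        rw [lintegral_map h1 (by fun_prop)]
    _ = ENNReal.ofReal ((t ^ m)⁻¹) * ∫⁻ y, F (x + y) := by
        rw [Measure.map_addHaar_smul volume ht.ne', lintegral_smul_measure, smul_eq_mul,
          finrank_euclideanSpace_fin, abs_of_pos (by positivity)]
    _ = ENNReal.ofReal ((t ^ m)⁻¹) * ∫⁻ y, F y := by rw [lintegral_add_left_eq_self F x]

theorem lintegral_Ioc_rpow_ne_top {r : ℝ} (hr : -1 < r) :
    ∫⁻ t in Ioc (0 : ℝ) 1, ENNReal.ofReal (t ^ r) ≠ ⊤ := by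
  have h : IntegrableOn (fun t : ℝ => t ^ r) (Ioc 0 1) :=
    (intervalIntegrable_iff_integrableOn_Ioc_of_le zero_le_one).1
      (intervalIntegral.intervalIntegrable_rpow' hr)
  exact h.lintegral_lt_top.ne

/-- Cauchy–Schwarz for the product of t^(-s/2) and t^(s/2) a. The weight t^s leaves room for the
singularity at t = 0 that the substitution y = x + t(z - x) creates later. -/
theorem sq_lintegral_Ioc_le (s : ℝ) {a : ℝ → ℝ≥0∞} (ha : Measurable a) :
    (∫⁻ t in Ioc (0 : ℝ) 1, a t) ^ 2 ≤ (∫⁻ t in Ioc (0 : ℝ) 1, ENNReal.ofReal (t ^ (-s))) *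
      ∫⁻ t in Ioc (0 : ℝ) 1, ENNReal.ofReal (t ^ s) * a t ^ 2 := by
  have h := ENNReal.lintegral_mul_le_Lp_mul_Lq (volume.restrict (Ioc (0 : ℝ) 1))
    Real.HolderConjugate.two_two (f := fun t => ENNReal.ofReal (t ^ (-s / 2)))
    (g := fun t => ENNReal.ofReal (t ^ (s / 2)) * a t) (by fun_prop) (by fun_prop)
  have e0 : ∫⁻ t in Ioc (0 : ℝ) 1, ((fun t => ENNReal.ofReal (t ^ (-s / 2))) *
      fun t => ENNReal.ofReal (t ^ (s / 2)) * a t) t = ∫⁻ t in Ioc (0 : ℝ) 1, a t := by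
    refine setLIntegral_congr_fun measurableSet_Ioc fun t ht => ?_
    simp only [Pi.mul_apply]
    rw [← mul_assoc, ← ENNReal.ofReal_mul (Real.rpow_nonneg ht.1.le _), ← Real.rpow_add ht.1]
    simp [neg_div]
  have e1 : ∫⁻ t in Ioc (0 : ℝ) 1, ENNReal.ofReal (t ^ (-s / 2)) ^ (2 : ℝ)
      = ∫⁻ t in Ioc (0 : ℝ) 1, ENNReal.ofReal (t ^ (-s)) := by
    refine setLIntegral_congr_fun measurableSet_Ioc fun t ht => ?_
    rw [ENNReal.ofReal_rpow_of_nonneg (Real.rpow_nonneg ht.1.le _) (by norm_num),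
      ← Real.rpow_mul ht.1.le]
    congr 2; ring
  have e2 : ∫⁻ t in Ioc (0 : ℝ) 1, (ENNReal.ofReal (t ^ (s / 2)) * a t) ^ (2 : ℝ)
      = ∫⁻ t in Ioc (0 : ℝ) 1, ENNReal.ofReal (t ^ s) * a t ^ 2 := by
    refine setLIntegral_congr_fun measurableSet_Ioc fun t ht => ?_
    rw [ENNReal.mul_rpow_of_nonneg _ _ (by norm_num),
      ENNReal.ofReal_rpow_of_nonneg (Real.rpow_nonneg ht.1.le _) (by norm_num),
      ← Real.rpow_mul ht.1.le, ENNReal.rpow_two]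
    congr 3; ring
  rw [e0, e1, e2] at h
  calc (∫⁻ t in Ioc (0 : ℝ) 1, a t) ^ 2 ≤ _ := pow_le_pow_left' h 2
    _ = _ := by
      rw [mul_pow, ← ENNReal.rpow_natCast, ← ENNReal.rpow_natCast, ← ENNReal.rpow_mul,
        ← ENNReal.rpow_mul]
      simp

/-- Hölder's inequality for the integral of a weight over a small ball. -/
theorem setLIntegral_inter_closedBall_le {q : ℝ} (hq : 1 < q) {w : Rm m → ℝ≥0∞} (hw : Measurable w)
    {P : Set (Rm m)} (y : Rm m) {ρ : ℝ} (hρ : 0 ≤ ρ) :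
    ∫⁻ x in P, w x * (Metric.closedBall y ρ).indicator 1 x ≤
      (∫⁻ x in P, w x ^ q) ^ (1 / q) *
        (ENNReal.ofReal (ρ ^ (m * (1 - 1 / q))) * volume (Metric.ball (0 : Rm m) 1) ^ (1 - 1 / q)) := by
  have hpq : q.HolderConjugate (q / (q - 1)) := Real.HolderConjugate.conjExponent hq
  have hp : 1 / (q / (q - 1)) = 1 - 1 / q := by
    have : q - 1 ≠ 0 := by linarith
    field_simp
  have h := ENNReal.lintegral_mul_le_Lp_mul_Lq (volume.restrict P) hpq (f := w)
    (g := (Metric.closedBall y ρ).indicator 1) hw.aemeasurable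
    ((measurable_one.indicator Metric.isClosed_closedBall.measurableSet).aemeasurable)
  refine h.trans ?_
  gcongr
  rw [hp]
  have hq1 : 0 < 1 - 1 / q := by
    rw [sub_pos, div_lt_one (by linarith)]; exact hq
  calc (∫⁻ x in P, (Metric.closedBall y ρ).indicator (1 : Rm m → ℝ≥0∞) x ^ (q / (q - 1))) ^ (1 - 1 / q)
      ≤ (∫⁻ x, (Metric.closedBall y ρ).indicator (1 : Rm m → ℝ≥0∞) x) ^ (1 - 1 / q) := by
        gcongr ?_ ^ _
        refine (setLIntegral_le_lintegral _ _).trans (lintegral_mono fun x => ?_)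
        by_cases hx : x ∈ Metric.closedBall y ρ
        · simp [hx]
        · have : 0 < q / (q - 1) := hpq.symm.pos
          simp [hx, this]
    _ = (volume (Metric.closedBall y ρ)) ^ (1 - 1 / q) := by
        rw [lintegral_indicator_one Metric.isClosed_closedBall.measurableSet]
    _ = _ := by
        rw [Measure.addHaar_closedBall volume y hρ, ENNReal.mul_rpow_of_nonneg _ _ hq1.le,
          finrank_euclideanSpace_fin, ENNReal.ofReal_rpow_of_nonneg (by positivity) hq1.le,
          ← Real.rpow_natCast, ← Real.rpow_mul hρ]

/-- The Euclidean norm squared of the vector with components `G i y`. -/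
noncomputable def gradSq (G : Fin m → Rm m → ℝ) (y : Rm m) : ℝ≥0∞ :=
  ENNReal.ofReal (∑ i, G i y ^ 2)

theorem measurable_gradSq {G : Fin m → Rm m → ℝ} (hG : ∀ i, Measurable (G i)) :
    Measurable (gradSq G) := by
  unfold gradSq; fun_prop

theorem enorm_sum_mul_sq_le (e : Rm m) (G : Fin m → Rm m → ℝ) (y : Rm m) :
    ‖∑ i, e i * G i y‖ₑ ^ 2 ≤ ENNReal.ofReal (‖e‖ ^ 2) * gradSq G y := by
  have h := Finset.sum_mul_sq_le_sq_mul_sq Finset.univ (fun i => e i) (fun i => G i y)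
  rw [← ofReal_norm, ← ENNReal.ofReal_pow (norm_nonneg _), gradSq,
    ← ENNReal.ofReal_mul (by positivity), EuclideanSpace.real_norm_sq_eq]
  refine ENNReal.ofReal_le_ofReal ?_
  rwa [Real.norm_eq_abs, sq_abs]

theorem HasWeakPartials.ae_ae_sq_sub_le {U : Set (Rm m)} (hU : IsOpen U) {v : Rm m → ℝ}
    {G : Fin m → Rm m → ℝ} (h : HasWeakPartials U v G) (hv : Measurable v)
    (hG : ∀ i, Measurable (G i)) (s : ℝ) :
    ∀ᵐ x, ∀ᵐ z, (∀ t ∈ Icc (0 : ℝ) 1, x + t • (z - x) ∈ U) →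
      ENNReal.ofReal ((v x - v z) ^ 2) ≤ (∫⁻ t in Ioc (0 : ℝ) 1, ENNReal.ofReal (t ^ (-s))) *
        (ENNReal.ofReal (‖z - x‖ ^ 2) *
          ∫⁻ t in Ioc (0 : ℝ) 1, ENNReal.ofReal (t ^ s) * gradSq G (x + t • (z - x))) := by
  have h1 : ∀ᵐ x, ∀ᵐ e : Rm m, (∀ t ∈ Icc (0 : ℝ) 1, x + t • e ∈ U) →
      ‖v (x + e) - v x‖ₑ ≤ ∫⁻ t in Ioc (0 : ℝ) 1, ‖∑ i, e i * G i (x + t • e)‖ₑ := by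
    -- The segment identity holds for every e and almost every x. Exchanging the quantifiers needs a
    -- measurable exceptional set, which is why v and G are assumed measurable.
    rw [Measure.ae_ae_comm]
    · refine Eventually.of_forall fun e => ?_
      filter_upwards [h.ae_sub_eq_integral hU e] with x hx hs
      rw [hx hs, intervalIntegral.integral_of_le zero_le_one]
      exact enorm_integral_le_lintegral_enorm _
    · have ho : IsOpen {p : Rm m × Rm m | ∀ t ∈ Icc (0 : ℝ) 1, p.1 + t • p.2 ∈ U} := by
        rw [isOpen_iff_mem_nhds]
        intro p hp
        have : ∀ᶠ y in 𝓝 p, ∀ t ∈ Icc (0 : ℝ) 1, y.1 + t • y.2 ∈ U := by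
          refine isCompact_Icc.eventually_forall_of_forall_eventually fun t ht => ?_
          have hcont : Continuous fun z : (Rm m × Rm m) × ℝ => z.1.1 + z.2 • z.1.2 := by fun_prop
          exact hcont.continuousAt.preimage_mem_nhds (hU.mem_nhds (hp t ht))
        exact this
      have hm : Measurable fun p : Rm m × Rm m =>
          ∫⁻ t in Ioc (0 : ℝ) 1, ‖∑ i, p.2 i * G i (p.1 + t • p.2)‖ₑ := by
        refine Measurable.lintegral_prod_right'
          (f := fun z : (Rm m × Rm m) × ℝ => ‖∑ i, z.1.2 i * G i (z.1.1 + z.2 • z.1.2)‖ₑ) ?_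
        fun_prop
      have hm2 : Measurable fun p : Rm m × Rm m => ‖v (p.1 + p.2) - v p.1‖ₑ := by fun_prop
      exact ho.measurableSet.imp (measurableSet_le hm2 hm)
  filter_upwards [h1] with x hx
  have h2 : Tendsto (fun z => z - x) (ae (volume : Measure (Rm m))) (ae volume) :=
    (measurePreserving_sub_right volume x).quasiMeasurePreserving.tendsto_ae
  filter_upwards [h2.eventually hx] with z hz hs
  have h3 := hz hs
  rw [add_sub_cancel] at h3
  have h4 := sq_lintegral_Ioc_le s
    (a := fun t => ‖∑ i, (z - x) i * G i (x + t • (z - x))‖ₑ) (by fun_prop)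
  calc ENNReal.ofReal ((v x - v z) ^ 2) = ‖v z - v x‖ₑ ^ 2 := by
        rw [← ofReal_norm, ← ENNReal.ofReal_pow (norm_nonneg _), Real.norm_eq_abs, sq_abs]
        congr 1; ring
    _ ≤ (∫⁻ t in Ioc (0 : ℝ) 1, ‖∑ i, (z - x) i * G i (x + t • (z - x))‖ₑ) ^ 2 := by gcongr
    _ ≤ _ := h4
    _ ≤ _ := by
      gcongr
      rw [← lintegral_const_mul' _ _ ENNReal.ofReal_ne_top]
      refine lintegral_mono fun t => ?_
      calc _ ≤ ENNReal.ofReal (t ^ s) *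
            (ENNReal.ofReal (‖z - x‖ ^ 2) * gradSq G (x + t • (z - x))) := by
            gcongr
            exact enorm_sum_mul_sq_le _ _ _
        _ = _ := by ring

/-- The double integral form of the weighted Poincaré inequality, with a constant that depends only
on the dimension and on the exponent of integrability of the weight. -/
theorem exists_lintegral_lintegral_sq_sub_le (m : ℕ) {q : ℝ} (hq : 1 < q) (hmq : m < 2 * q) :
    ∃ C : ℝ≥0∞, C ≠ ⊤ ∧ ∀ {U : Set (Rm m)}, IsOpen U → ∀ {v : Rm m → ℝ} {G : Fin m → Rm m → ℝ},
      HasWeakPartials U v G → Measurable v → (∀ i, Measurable (G i)) →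
      ∀ {w : Rm m → ℝ≥0∞}, Measurable w → ∀ {P : Set (Rm m)}, MeasurableSet P → Convex ℝ P →
      ∀ {d : ℝ}, 0 < d → (∀ x ∈ P, ∀ z ∈ P, ‖z - x‖ ≤ d) →
      (∀ᵐ x, ∀ᵐ z, x ∈ P → z ∈ P → ∀ t ∈ Icc (0 : ℝ) 1, x + t • (z - x) ∈ U) →
      ∫⁻ z in P, ∫⁻ x in P, ENNReal.ofReal ((v x - v z) ^ 2) * w x ≤
        C * ENNReal.ofReal (d ^ (2 + m - m / q)) * (∫⁻ x in P, w x ^ q) ^ (1 / q) *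
          ∫⁻ y in P, gradSq G y := by
  have hq0 : 0 < q := by linarith
  -- The exponent is chosen so that t^s (Cauchy–Schwarz), t^(-m) (Jacobian) and t^(m - m/q) (Hölder
  -- on a ball of radius t d) multiply to t^(-s); then the same integral A appears twice. The
  -- condition m < 2q is s < 1, that is, A is finite.
  set s : ℝ := m / (2 * q) with hs
  have hs1 : s < 1 := by rw [hs, div_lt_one (by positivity)]; exact hmq
  set A : ℝ≥0∞ := ∫⁻ t in Ioc (0 : ℝ) 1, ENNReal.ofReal (t ^ (-s)) with hA
  have hAtop : A ≠ ⊤ := lintegral_Ioc_rpow_ne_top (by linarith)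
  set κ : ℝ≥0∞ := volume (Metric.ball (0 : Rm m) 1) ^ (1 - 1 / q) with hκ
  have hκtop : κ ≠ ⊤ := by
    refine ENNReal.rpow_ne_top_of_nonneg ?_ measure_ball_lt_top.ne
    rw [sub_nonneg, div_le_one hq0]; exact hq.le
  refine ⟨A * A * κ, by finiteness, ?_⟩
  intro U hU v G h hv hG w hw P hP hPc d hd hPd hseg
  set g : Rm m → ℝ≥0∞ := P.indicator (gradSq G) with hg
  have hgm : Measurable g := (measurable_gradSq hG).indicator hP
  set W := (∫⁻ x in P, w x ^ q) ^ (1 / q) with hW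
  set I := ∫⁻ y in P, gradSq G y with hI
  set k : Rm m → ℝ → Rm m → ℝ≥0∞ := fun x t y =>
    (Metric.closedBall y (t * d)).indicator 1 x with hkdef
  have hk : Measurable fun p : Rm m × ℝ × Rm m => k p.1 p.2.1 p.2.2 := by
    have hset : MeasurableSet {p : Rm m × ℝ × Rm m | dist p.1 p.2.2 ≤ p.2.1 * d} :=
      measurableSet_le (by fun_prop) (by fun_prop)
    exact (measurable_one (α := ℝ≥0∞)).indicator hset
  have hVd : ENNReal.ofReal (d ^ 2) * ENNReal.ofReal (d ^ (m * (1 - 1 / q)))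
      = ENNReal.ofReal (d ^ (2 + m - m / q)) := by
    rw [← ENNReal.ofReal_mul (by positivity), ← Real.rpow_natCast d 2, ← Real.rpow_add hd]
    congr 2; push_cast; ring
  -- By convexity the segments stay in P, so the gradient may be cut off to P. The new variable y =
  -- x + t(z - x) satisfies |y - x| ≤ t d, which the kernel k records.
  have step1 : ∀ᵐ x, x ∈ P → ∫⁻ z in P, ENNReal.ofReal ((v x - v z) ^ 2) * w x ≤
      A * ENNReal.ofReal (d ^ 2) * (w x * ∫⁻ t in Ioc (0 : ℝ) 1,
        ENNReal.ofReal (t ^ s) * (ENNReal.ofReal ((t ^ m)⁻¹) * ∫⁻ y, k x t y * g y)) := by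
    filter_upwards [h.ae_ae_sq_sub_le hU hv hG s, hseg] with x hx1 hx2 hxP
    have hmeas : Measurable fun p : Rm m × ℝ =>
        ENNReal.ofReal (p.2 ^ s) * g (x + p.2 • (p.1 - x)) := by
      refine Measurable.mul (by fun_prop) (hgm.comp (by fun_prop))
    calc ∫⁻ z in P, ENNReal.ofReal ((v x - v z) ^ 2) * w x
        ≤ ∫⁻ z in P, A * ENNReal.ofReal (d ^ 2) * w x *
            ∫⁻ t in Ioc (0 : ℝ) 1, ENNReal.ofReal (t ^ s) * g (x + t • (z - x)) := by
          refine lintegral_mono_ae ((ae_restrict_iff' hP).2 ?_)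
          filter_upwards [hx1, hx2] with z hz1 hz2 hzP
          have hz3 := hz1 (hz2 hxP hzP)
          have e1 : ∫⁻ t in Ioc (0 : ℝ) 1, ENNReal.ofReal (t ^ s) * gradSq G (x + t • (z - x))
              = ∫⁻ t in Ioc (0 : ℝ) 1, ENNReal.ofReal (t ^ s) * g (x + t • (z - x)) := by
            refine setLIntegral_congr_fun measurableSet_Ioc fun t ht => ?_
            have : x + t • (z - x) ∈ P := by
              have := hPc.add_smul_sub_mem hxP hzP (Ioc_subset_Icc_self ht)
              exact this
            simp only [hg, indicator_of_mem this]
          rw [e1] at hz3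
          calc ENNReal.ofReal ((v x - v z) ^ 2) * w x
              ≤ A * (ENNReal.ofReal (‖z - x‖ ^ 2) *
                  ∫⁻ t in Ioc (0 : ℝ) 1, ENNReal.ofReal (t ^ s) * g (x + t • (z - x))) * w x := by
                gcongr
            _ ≤ A * (ENNReal.ofReal (d ^ 2) *
                  ∫⁻ t in Ioc (0 : ℝ) 1, ENNReal.ofReal (t ^ s) * g (x + t • (z - x))) * w x := by
                gcongr
                exact hPd x hxP z hzP
            _ = _ := by ring
      _ = A * ENNReal.ofReal (d ^ 2) * w x * ∫⁻ z in P,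
            ∫⁻ t in Ioc (0 : ℝ) 1, ENNReal.ofReal (t ^ s) * g (x + t • (z - x)) := by
          rw [lintegral_const_mul _ hmeas.lintegral_prod_right']
      _ = A * ENNReal.ofReal (d ^ 2) * w x * ∫⁻ t in Ioc (0 : ℝ) 1,
            ∫⁻ z in P, ENNReal.ofReal (t ^ s) * g (x + t • (z - x)) := by
          rw [lintegral_lintegral_swap hmeas.aemeasurable]
      _ ≤ A * ENNReal.ofReal (d ^ 2) * w x * ∫⁻ t in Ioc (0 : ℝ) 1,
            ENNReal.ofReal (t ^ s) * (ENNReal.ofReal ((t ^ m)⁻¹) * ∫⁻ y, k x t y * g y) := by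
          refine mul_le_mul' le_rfl ?_
          refine setLIntegral_mono' measurableSet_Ioc fun t ht => ?_
          rw [lintegral_const_mul' _ _ ENNReal.ofReal_ne_top]
          gcongr
          have hFm : Measurable fun y => k x t y * g y :=
            (hk.comp (g := fun p : Rm m × ℝ × Rm m => k p.1 p.2.1 p.2.2)
              (f := fun y : Rm m => (x, t, y)) (by fun_prop)).mul hgm
          rw [← lintegral_homothety hFm x ht.1, ← lintegral_indicator hP]
          refine lintegral_mono fun z => ?_
          by_cases hz : z ∈ P
          · have hmem : x ∈ Metric.closedBall (x + t • (z - x)) (t * d) := by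
              rw [Metric.mem_closedBall, dist_comm, dist_eq_norm, add_sub_cancel_left, norm_smul,
                Real.norm_of_nonneg ht.1.le]
              exact mul_le_mul_of_nonneg_left (hPd x hxP z hz) ht.1.le
            simp [hz, hkdef, indicator_of_mem hmem]
          · simp [hz]
      _ = _ := by ring
  have hmeas3 : Measurable fun p : (Rm m × ℝ) × Rm m => k p.1.1 p.1.2 p.2 * g p.2 :=
    (hk.comp (g := fun p : Rm m × ℝ × Rm m => k p.1 p.2.1 p.2.2)
      (f := fun p : (Rm m × ℝ) × Rm m => (p.1.1, p.1.2, p.2)) (by fun_prop)).mul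
      (hgm.comp measurable_snd)
  have hmeas2 : Measurable fun p : Rm m × ℝ => ∫⁻ y, k p.1 p.2 y * g y :=
    hmeas3.lintegral_prod_right'
  have hmeasJ : Measurable fun p : Rm m × ℝ => w p.1 * (ENNReal.ofReal (p.2 ^ s) *
      (ENNReal.ofReal ((p.2 ^ m)⁻¹) * ∫⁻ y, k p.1 p.2 y * g y)) := by fun_prop
  calc ∫⁻ z in P, ∫⁻ x in P, ENNReal.ofReal ((v x - v z) ^ 2) * w x
      = ∫⁻ x in P, ∫⁻ z in P, ENNReal.ofReal ((v x - v z) ^ 2) * w x := by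
        refine lintegral_lintegral_swap (Measurable.aemeasurable ?_)
        fun_prop
    _ ≤ ∫⁻ x in P, A * ENNReal.ofReal (d ^ 2) * (w x * ∫⁻ t in Ioc (0 : ℝ) 1,
          ENNReal.ofReal (t ^ s) * (ENNReal.ofReal ((t ^ m)⁻¹) * ∫⁻ y, k x t y * g y)) :=
        lintegral_mono_ae ((ae_restrict_iff' hP).2 step1)
    _ = A * ENNReal.ofReal (d ^ 2) * ∫⁻ x in P, ∫⁻ t in Ioc (0 : ℝ) 1, w x *
          (ENNReal.ofReal (t ^ s) * (ENNReal.ofReal ((t ^ m)⁻¹) * ∫⁻ y, k x t y * g y)) := by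
        rw [← lintegral_const_mul _ hmeasJ.lintegral_prod_right']
        refine lintegral_congr fun x => ?_
        dsimp only
        rw [lintegral_const_mul]
        have : Measurable fun t : ℝ => ∫⁻ y, k x t y * g y :=
          hmeas2.comp (f := fun t : ℝ => (x, t)) (by fun_prop)
        fun_prop
    _ = A * ENNReal.ofReal (d ^ 2) * ∫⁻ t in Ioc (0 : ℝ) 1, ∫⁻ x in P, w x *
          (ENNReal.ofReal (t ^ s) * (ENNReal.ofReal ((t ^ m)⁻¹) * ∫⁻ y, k x t y * g y)) := by
        rw [lintegral_lintegral_swap hmeasJ.aemeasurable]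
    _ ≤ A * ENNReal.ofReal (d ^ 2) * ∫⁻ t in Ioc (0 : ℝ) 1, ENNReal.ofReal (t ^ (-s)) *
          (ENNReal.ofReal (d ^ (m * (1 - 1 / q))) * κ * W * I) := by
        refine mul_le_mul' le_rfl ?_
        refine setLIntegral_mono' measurableSet_Ioc fun t ht => ?_
        have hkt : Measurable fun p : Rm m × Rm m => k p.1 t p.2 :=
          hk.comp (g := fun p : Rm m × ℝ × Rm m => k p.1 p.2.1 p.2.2)
            (f := fun p : Rm m × Rm m => (p.1, t, p.2)) (by fun_prop)
        have hkg : Measurable fun p : Rm m × Rm m => w p.1 * (k p.1 t p.2 * g p.2) := by fun_prop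
        calc ∫⁻ x in P, w x *
              (ENNReal.ofReal (t ^ s) * (ENNReal.ofReal ((t ^ m)⁻¹) * ∫⁻ y, k x t y * g y))
            = ENNReal.ofReal (t ^ s) * ENNReal.ofReal ((t ^ m)⁻¹) *
                ∫⁻ x in P, ∫⁻ y, w x * (k x t y * g y) := by
              rw [← lintegral_const_mul _ hkg.lintegral_prod_right']
              refine lintegral_congr fun x => ?_
              dsimp only
              rw [lintegral_const_mul]
              · ring
              · have : Measurable fun y : Rm m => k x t y :=
                  hkt.comp (f := fun y : Rm m => (x, y)) (by fun_prop)
                fun_prop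
          _ = ENNReal.ofReal (t ^ s) * ENNReal.ofReal ((t ^ m)⁻¹) *
                ∫⁻ y, ∫⁻ x in P, w x * (k x t y * g y) := by
              rw [lintegral_lintegral_swap hkg.aemeasurable]
          -- After the exchange of integrals, x ranges for fixed y over a ball of radius t d, so
          -- only the mass of w in that ball is needed.
          _ ≤ ENNReal.ofReal (t ^ s) * ENNReal.ofReal ((t ^ m)⁻¹) *
                ∫⁻ y, (W * (ENNReal.ofReal ((t * d) ^ (m * (1 - 1 / q))) * κ)) * g y := by
              gcongr with y
              have hky : Measurable fun x : Rm m => k x t y :=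
                hkt.comp (f := fun x : Rm m => (x, y)) (by fun_prop)
              calc ∫⁻ x in P, w x * (k x t y * g y) = (∫⁻ x in P, w x * k x t y) * g y := by
                    rw [← lintegral_mul_const _ (by fun_prop)]
                    exact lintegral_congr fun x => by ring
                _ ≤ _ := by
                    gcongr
                    exact setLIntegral_inter_closedBall_le hq hw y (by have := ht.1; positivity)
          _ = ENNReal.ofReal (t ^ s) * ENNReal.ofReal ((t ^ m)⁻¹) *
                ENNReal.ofReal ((t * d) ^ (m * (1 - 1 / q))) * κ * W * I := by
              rw [lintegral_const_mul _ hgm, hg, lintegral_indicator hP]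
              ring
          _ = _ := by
              have e : ENNReal.ofReal (t ^ s) * ENNReal.ofReal ((t ^ m)⁻¹) *
                  ENNReal.ofReal ((t * d) ^ (m * (1 - 1 / q))) =
                  ENNReal.ofReal (t ^ (-s)) * ENNReal.ofReal (d ^ (m * (1 - 1 / q))) := by
                have ht0 := ht.1
                rw [Real.mul_rpow ht0.le hd.le, ← ENNReal.ofReal_mul (by positivity),
                  ← ENNReal.ofReal_mul (by positivity), ← ENNReal.ofReal_mul (by positivity),
                  ← mul_assoc, ← Real.rpow_natCast t m, ← Real.rpow_neg ht0.le,
                  ← Real.rpow_add ht0, ← Real.rpow_add ht0]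
                congr 3
                rw [hs]; field_simp; ring
              rw [e]; ring
    _ = A * A * κ * (ENNReal.ofReal (d ^ 2) * ENNReal.ofReal (d ^ (m * (1 - 1 / q)))) * W * I := by
        rw [lintegral_mul_const _ (by fun_prop)]
        ring
    _ = _ := by rw [hVd]

end WeightedPoincare

/-! ### Half-open lattice cubes. -/

section LatticeCubes

variable {m : ℕ}

/-- The half-open cube of side `ℓ` with lower corner `ℓ k`. -/
def latticeCube (ℓ : ℝ) (k : Fin m → ℤ) : Set (Rm m) :=
  {x | ∀ i, x i ∈ Ico (ℓ * k i) (ℓ * (k i + 1))}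

theorem measurableSet_latticeCube (ℓ : ℝ) (k : Fin m → ℤ) : MeasurableSet (latticeCube ℓ k) := by
  have : latticeCube ℓ k = ⋂ i, (fun x : Rm m => x i) ⁻¹' Ico (ℓ * k i) (ℓ * (k i + 1)) := by
    ext x; simp [latticeCube]
  rw [this]
  exact MeasurableSet.iInter fun i => measurableSet_Ico.preimage (by fun_prop)

theorem convex_latticeCube (ℓ : ℝ) (k : Fin m → ℤ) : Convex ℝ (latticeCube ℓ k) := by
  intro x hx y hy a b ha hb hab i
  exact (convex_Ico (ℓ * k i) (ℓ * ((k i : ℝ) + 1))) (hx i) (hy i) ha hb hab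

theorem mem_latticeCube_floor {ℓ : ℝ} (hℓ : 0 < ℓ) (x : Rm m) :
    x ∈ latticeCube ℓ (fun i => ⌊x i / ℓ⌋) := by
  intro i
  have h1 := Int.floor_le (x i / ℓ)
  have h2 := Int.lt_floor_add_one (x i / ℓ)
  rw [le_div_iff₀ hℓ] at h1
  rw [div_lt_iff₀ hℓ] at h2
  exact ⟨by linarith, by linarith⟩

theorem norm_sub_le_of_mem_latticeCube {ℓ : ℝ} (hℓ : 0 < ℓ) {k : Fin m → ℤ} {x z : Rm m}
    (hx : x ∈ latticeCube ℓ k) (hz : z ∈ latticeCube ℓ k) : ‖z - x‖ ≤ m * ℓ := by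
  have h1 : ‖z - x‖ ^ 2 ≤ m * ℓ ^ 2 := by
    rw [EuclideanSpace.real_norm_sq_eq]
    calc ∑ i, ((z - x) i) ^ 2 ≤ ∑ _i : Fin m, ℓ ^ 2 := by
          refine Finset.sum_le_sum fun i _ => sq_le_sq' ?_ ?_
          · have := (hx i).2; have := (hz i).1; simp only [PiLp.sub_apply]; nlinarith
          · have := (hx i).1; have := (hz i).2; simp only [PiLp.sub_apply]; nlinarith
      _ = m * ℓ ^ 2 := by simp
  have h2 : (m : ℝ) ≤ (m : ℝ) ^ 2 := by
    have : m ≤ m ^ 2 := Nat.le_self_pow (by norm_num) m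
    exact_mod_cast this
  refine abs_le_of_sq_le_sq' (a := ‖z - x‖) (b := m * ℓ) ?_ (by positivity) |>.2
  rw [mul_pow]
  nlinarith [sq_nonneg ℓ]

theorem volume_latticeCube {ℓ : ℝ} (hℓ : 0 < ℓ) (k : Fin m → ℤ) :
    volume (latticeCube ℓ k) = ENNReal.ofReal (ℓ ^ m) := by
  have e : latticeCube ℓ k = WithLp.ofLp ⁻¹'
      (univ.pi fun i => Ico (ℓ * k i) (ℓ * ((k i : ℝ) + 1))) := by
    ext x; simp [latticeCube]
  rw [e, (PiLp.volume_preserving_ofLp (Fin m)).measure_preimage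
    (MeasurableSet.univ_pi fun i => measurableSet_Ico).nullMeasurableSet, Real.volume_pi_Ico]
  have : ∀ i : Fin m, ℓ * ((k i : ℝ) + 1) - ℓ * k i = ℓ := fun i => by ring
  simp [this, ENNReal.ofReal_pow hℓ.le]

end LatticeCubes

/-! ### Approximation by constants on cubes. -/

section CubeEstimate

variable {m : ℕ}

theorem HasWeakPartials.congr {U : Set (Rm m)} {v v' : Rm m → ℝ}
    {G G' : Fin m → Rm m → ℝ}
    (h : HasWeakPartials U v G) (hv : v =ᵐ[volume.restrict U] v')
    (hG : ∀ i, G i =ᵐ[volume.restrict U] G' i) : HasWeakPartials U v' G' := by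
  have loc : ∀ {a b : Rm m → ℝ}, a =ᵐ[volume.restrict U] b → LocallyIntegrableOn a U volume →
      LocallyIntegrableOn b U volume := by
    intro a b hab ha x hx
    obtain ⟨t, ht, hat⟩ := ha x hx
    refine ⟨t ∩ U, inter_mem ht self_mem_nhdsWithin, ?_⟩
    exact (hat.mono_set inter_subset_left).congr (ae_restrict_of_ae_restrict_of_subset inter_subset_right hab)
  refine ⟨loc hv h.1, fun i => ⟨loc (hG i) (h.2 i).1, fun ψ hψ hc hs => ?_⟩⟩
  have e1 : ∫ y in U, v' y * fderiv ℝ ψ y (EuclideanSpace.single i (1 : ℝ))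
      = ∫ y in U, v y * fderiv ℝ ψ y (EuclideanSpace.single i (1 : ℝ)) :=
    integral_congr_ae (by filter_upwards [hv] with y hy; rw [hy])
  have e2 : ∫ y in U, G' i y * ψ y = ∫ y in U, G i y * ψ y :=
    integral_congr_ae (by filter_upwards [hG i] with y hy; rw [hy])
  rw [e1, e2]
  exact (h.2 i).2 ψ hψ hc hs

/-- The double integral estimate divided by the volume ℓ^m of the cube: some z has its inner
integral at most the average over z, and the value of v there serves as the constant c. -/
theorem exists_lintegral_latticeCube_sq_sub_le (hm : 0 < m) {q : ℝ} (hq : 1 < q)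
    (hmq : m < 2 * q) :
    ∃ C : ℝ≥0∞, C ≠ ⊤ ∧ ∀ {U : Set (Rm m)}, IsOpen U → ∀ {w : Rm m → ℝ≥0∞},
      AEMeasurable w (volume.restrict U) → ∀ {ℓ : ℝ}, 0 < ℓ → ∀ k : Fin m → ℤ,
      (∀ᵐ x, ∀ᵐ z, x ∈ latticeCube ℓ k → z ∈ latticeCube ℓ k →
        ∀ t ∈ Icc (0 : ℝ) 1, x + t • (z - x) ∈ U) →
      ∀ {v : Rm m → ℝ} {G : Fin m → Rm m → ℝ}, HasWeakPartials U v G → ∃ c : ℝ,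
      ∫⁻ x in latticeCube ℓ k ∩ U, ENNReal.ofReal ((v x - c) ^ 2) * w x ≤
        C * ENNReal.ofReal (ℓ ^ (2 - m / q)) *
          (∫⁻ x in latticeCube ℓ k ∩ U, w x ^ q) ^ (1 / q) *
          ∫⁻ y in latticeCube ℓ k ∩ U, gradSq G y := by
  obtain ⟨C, hC, H⟩ := exists_lintegral_lintegral_sq_sub_le m hq hmq
  have hm' : (0 : ℝ) < m := by exact_mod_cast hm
  refine ⟨C * ENNReal.ofReal ((m : ℝ) ^ (2 + m - m / q : ℝ)), by finiteness, ?_⟩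
  intro U hU w hw ℓ hℓ k hseg v G h
  set P := latticeCube ℓ k with hP
  have hPm : MeasurableSet P := measurableSet_latticeCube ℓ k
  have hUm := hU.measurableSet
  have hva : AEMeasurable v (volume.restrict U) := h.1.aestronglyMeasurable.aemeasurable
  have hGa : ∀ i, AEMeasurable (G i) (volume.restrict U) := fun i =>
    (h.2 i).1.aestronglyMeasurable.aemeasurable
  -- The double integral estimate needs functions measurable on the whole space, and the cube need
  -- not lie in U. Setting the gradient and the weight to zero off U makes integrals over the cube
  -- equal to integrals over its part in U; v needs no cutoff, as it occurs there only multiplied by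
  -- the weight.
  set v' := hva.mk v with hv'
  set G' : Fin m → Rm m → ℝ := fun i => U.indicator ((hGa i).mk (G i)) with hG'
  set w' : Rm m → ℝ≥0∞ := U.indicator (hw.mk w) with hw'
  have eG : ∀ i, G i =ᵐ[volume.restrict U] G' i := fun i =>
    (hGa i).ae_eq_mk.trans (indicator_ae_eq_restrict hUm).symm
  have ew : w =ᵐ[volume.restrict U] w' :=
    hw.ae_eq_mk.trans (indicator_ae_eq_restrict hUm).symm
  have hv'm : Measurable v' := hva.measurable_mk
  have hG'm : ∀ i, Measurable (G' i) := fun i => (hGa i).measurable_mk.indicator hUm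
  have hw'm : Measurable w' := hw.measurable_mk.indicator hUm
  have h' := h.congr hva.ae_eq_mk eG
  have main := H hU h' hv'm hG'm hw'm hPm (convex_latticeCube ℓ k) (d := m * ℓ) (by positivity)
    (fun x hx z hz => norm_sub_le_of_mem_latticeCube hℓ hx hz) hseg
  have restr : ∀ {F F' : Rm m → ℝ≥0∞}, F =ᵐ[volume.restrict U] F' → (∀ x ∉ U, F' x = 0) →
      ∫⁻ x in P, F' x = ∫⁻ x in P ∩ U, F x := by
    intro F F' hF h0
    have hz : F' = U.indicator F' := by
      ext x; by_cases hx : x ∈ U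
      · simp [hx]
      · simp [hx, h0 x hx]
    rw [hz, setLIntegral_indicator hUm, inter_comm]
    exact lintegral_congr_ae (ae_restrict_of_ae_restrict_of_subset inter_subset_right hF.symm)
  have hvolP : volume P = ENNReal.ofReal (ℓ ^ m) := volume_latticeCube hℓ k
  have hmeas : Measurable fun z => ∫⁻ x in P, ENNReal.ofReal ((v' x - v' z) ^ 2) * w' x :=
    Measurable.lintegral_prod_right'
      (f := fun p : Rm m × Rm m => ENNReal.ofReal ((v' p.2 - v' p.1) ^ 2) * w' p.2) (by fun_prop)
  obtain ⟨z, -, hz⟩ := exists_le_setLAverage (μ := volume) (s := P)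
    (by rw [hvolP]; simp; positivity) (by rw [hvolP]; finiteness) hmeas.aemeasurable
  refine ⟨v' z, ?_⟩
  have e1 : ∫⁻ x in P, ENNReal.ofReal ((v' x - v' z) ^ 2) * w' x
      = ∫⁻ x in P ∩ U, ENNReal.ofReal ((v x - v' z) ^ 2) * w x := by
    refine restr ?_ fun x hx => by simp [hw', hx]
    filter_upwards [hva.ae_eq_mk, ew] with x h1 h2
    rw [← hv', h2] at *
    rw [h1]
  have e2 : ∫⁻ x in P, w' x ^ q = ∫⁻ x in P ∩ U, w x ^ q := by
    refine restr ?_ fun x hx => by simp [hw', hx]; linarith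
    filter_upwards [ew] with x h2
    rw [h2]
  have e3 : ∫⁻ x in P, gradSq G' x = ∫⁻ x in P ∩ U, gradSq G x := by
    refine restr ?_ fun x hx => by simp [hG', hx, gradSq]
    filter_upwards [ae_all_iff.2 eG] with x h2
    simp only [gradSq, h2]
  rw [← e1, ← e2, ← e3]
  refine hz.trans ?_
  rw [setLAverage_eq, hvolP]
  refine (ENNReal.div_le_div_right main _).trans (le_of_eq ?_)
  have hpow : ENNReal.ofReal ((m * ℓ) ^ (2 + m - m / q : ℝ)) =
      ENNReal.ofReal ((m : ℝ) ^ (2 + m - m / q : ℝ)) * ENNReal.ofReal (ℓ ^ (2 - m / q : ℝ)) *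
        ENNReal.ofReal (ℓ ^ m) := by
    rw [← ENNReal.ofReal_mul (by positivity), ← ENNReal.ofReal_mul (by positivity),
      Real.mul_rpow hm'.le hℓ.le, mul_assoc, ← Real.rpow_natCast ℓ m, ← Real.rpow_add hℓ]
    congr 3; ring
  rw [hpow, div_eq_mul_inv]
  have hone : ENNReal.ofReal (ℓ ^ m) * (ENNReal.ofReal (ℓ ^ m))⁻¹ = 1 :=
    ENNReal.mul_inv_cancel (by simp; positivity) ENNReal.ofReal_ne_top
  calc _ = C * ENNReal.ofReal ((m : ℝ) ^ (2 + m - m / q : ℝ)) * ENNReal.ofReal (ℓ ^ (2 - m / q : ℝ)) *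
        (∫⁻ x in P, w' x ^ q) ^ (1 / q) * (∫⁻ y in P, gradSq G' y) *
        (ENNReal.ofReal (ℓ ^ m) * (ENNReal.ofReal (ℓ ^ m))⁻¹) := by ring
    _ = _ := by rw [hone, mul_one]

/-- On a ball, functions with weak partial derivatives are approximated in `L²(w)` by functions that
are constant on the pieces of a finite partition, with an error controlled by the Dirichlet
integral. -/
theorem exists_finite_partition_lintegral_sq_sub_le (hm : 0 < m) {q : ℝ} (hq : 1 < q)
    (hmq : m < 2 * q) {U : Set (Rm m)} (hU : IsOpen U) {w : Rm m → ℝ≥0∞}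
    (hw : AEMeasurable w (volume.restrict U)) {y₀ : Rm m} {r : ℝ} (hr : 0 < r)
    (hwq : ∫⁻ x in Metric.closedBall y₀ (2 * r) ∩ U, w x ^ q ≠ ⊤)
    (hseg : ∀ᵐ x, ∀ᵐ z, x ∈ Metric.closedBall y₀ (2 * r) → z ∈ Metric.closedBall y₀ (2 * r) →
      ∀ t ∈ Icc (0 : ℝ) 1, x + t • (z - x) ∈ U) {η : ℝ≥0∞} (hη : η ≠ 0) :
    ∃ (T : Finset (Fin m → ℤ)) (P : (Fin m → ℤ) → Set (Rm m)),
      (∀ k, MeasurableSet (P k)) ∧ Metric.closedBall y₀ r ⊆ ⋃ k ∈ T, P k ∧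
      (∀ k ∈ T, P k ⊆ Metric.closedBall y₀ (2 * r)) ∧
      ∀ {v : Rm m → ℝ} {G : Fin m → Rm m → ℝ}, HasWeakPartials U v G → ∃ c : (Fin m → ℤ) → ℝ,
        ∑ k ∈ T, ∫⁻ x in P k ∩ U, ENNReal.ofReal ((v x - c k) ^ 2) * w x ≤
          η * ∫⁻ y in Metric.closedBall y₀ (2 * r) ∩ U, gradSq G y := by
  obtain ⟨C, hC, H⟩ := exists_lintegral_latticeCube_sq_sub_le hm hq hmq
  set B := Metric.closedBall y₀ (2 * r) with hB
  set W := (∫⁻ x in B ∩ U, w x ^ q) ^ (1 / q) with hW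
  have hq0 : 0 < q := by linarith
  have hWtop : W ≠ ⊤ := ENNReal.rpow_ne_top_of_nonneg (by positivity) hwq
  have hpos : 0 < 2 - m / q := by
    rw [sub_pos, div_lt_iff₀ hq0]; exact hmq
  -- The exponent 2 - m/q is positive, so a fine mesh makes the constant small. The bound m ℓ ≤ r on
  -- the diameter keeps every cube that meets the ball of radius r inside the ball of radius 2r.
  obtain ⟨ℓ, hℓ, hℓr, hℓη⟩ : ∃ ℓ : ℝ, 0 < ℓ ∧ m * ℓ ≤ r ∧
      C * ENNReal.ofReal (ℓ ^ (2 - m / q)) * W ≤ η := by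
    have t1 : Tendsto (fun ℓ : ℝ => C * ENNReal.ofReal (ℓ ^ (2 - m / q)) * W) (𝓝[>] 0) (𝓝 0) := by
      have t0 : Tendsto (fun ℓ : ℝ => ENNReal.ofReal (ℓ ^ (2 - m / q))) (𝓝 0) (𝓝 0) := by
        have : ContinuousAt (fun ℓ : ℝ => ENNReal.ofReal (ℓ ^ (2 - m / q))) 0 :=
          (ENNReal.continuous_ofReal.continuousAt).comp
            (Real.continuousAt_rpow_const 0 _ (Or.inr hpos.le))
        simpa [ContinuousAt, Real.zero_rpow hpos.ne'] using this
      have := ENNReal.Tendsto.mul_const (ENNReal.Tendsto.const_mul t0 (Or.inr hC)) (Or.inr hWtop)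
      simpa using this.mono_left nhdsWithin_le_nhds
    have t2 : Tendsto (fun ℓ : ℝ => m * ℓ) (𝓝[>] 0) (𝓝 0) := by
      have : Continuous fun ℓ : ℝ => m * ℓ := by fun_prop
      simpa using (this.tendsto 0).mono_left nhdsWithin_le_nhds
    have := (t1.eventually_le_const (pos_iff_ne_zero.2 hη)).and
      ((t2.eventually_le_const hr).and self_mem_nhdsWithin)
    obtain ⟨ℓ, h1, h2, h3⟩ := this.exists
    exact ⟨ℓ, h3, h2, h1⟩
  have hfin : {k : Fin m → ℤ | (latticeCube ℓ k ∩ Metric.closedBall y₀ r).Nonempty}.Finite := by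
    refine (Set.finite_Icc (fun i => ⌊(y₀ i - r) / ℓ⌋) (fun i => ⌊(y₀ i + r) / ℓ⌋)).subset ?_
    rintro k ⟨x, hxk, hxB⟩
    have hfl : ∀ i, ⌊x i / ℓ⌋ = k i := by
      intro i
      rw [Int.floor_eq_iff, le_div_iff₀ hℓ, div_lt_iff₀ hℓ]
      exact ⟨by linarith [(hxk i).1], by linarith [(hxk i).2]⟩
    have hxi : ∀ i, |x i - y₀ i| ≤ r := by
      intro i
      have h1 := PiLp.norm_apply_le (x - y₀) i
      rw [mem_closedBall_iff_norm] at hxB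
      simpa using h1.trans hxB
    constructor
    · intro i
      rw [← hfl i]
      have := (abs_le.1 (hxi i)).1
      exact Int.floor_le_floor (div_le_div_of_nonneg_right (by linarith) hℓ.le)
    · intro i
      rw [← hfl i]
      have := (abs_le.1 (hxi i)).2
      exact Int.floor_le_floor (div_le_div_of_nonneg_right (by linarith) hℓ.le)
  have hsub : ∀ k ∈ hfin.toFinset, latticeCube ℓ k ⊆ B := by
    intro k hk z hz
    obtain ⟨x, hxk, hxB⟩ := (Set.Finite.mem_toFinset hfin).1 hk
    have h1 := norm_sub_le_of_mem_latticeCube hℓ hxk hz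
    rw [← dist_eq_norm] at h1
    have h2 := dist_triangle z x y₀
    rw [Metric.mem_closedBall] at hxB
    rw [hB, Metric.mem_closedBall]
    linarith
  refine ⟨hfin.toFinset, latticeCube ℓ, measurableSet_latticeCube ℓ, ?_, hsub, ?_⟩
  · intro x hx
    refine mem_iUnion₂.2 ⟨_, ?_, mem_latticeCube_floor hℓ x⟩
    exact (Set.Finite.mem_toFinset hfin).2 ⟨x, mem_latticeCube_floor hℓ x, hx⟩
  · intro v G h
    have hex : ∀ k, ∃ c : ℝ, k ∈ hfin.toFinset →
        ∫⁻ x in latticeCube ℓ k ∩ U, ENNReal.ofReal ((v x - c) ^ 2) * w x ≤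
          η * ∫⁻ y in latticeCube ℓ k ∩ U, gradSq G y := by
      intro k
      by_cases hk : k ∈ hfin.toFinset
      · obtain ⟨c, hc⟩ := H hU hw hℓ k (by
          filter_upwards [hseg] with x hx
          filter_upwards [hx] with z hz hxk hzk
          exact hz (hsub k hk hxk) (hsub k hk hzk)) h
        refine ⟨c, fun _ => hc.trans ?_⟩
        gcongr
        refine le_trans ?_ hℓη
        rw [hW]
        gcongr
        exact hsub k hk
      · exact ⟨0, fun h => absurd h hk⟩
    choose c hc using hex
    refine ⟨c, (Finset.sum_le_sum fun k hk => hc k hk).trans ?_⟩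
    rw [← Finset.mul_sum]
    gcongr
    rw [← lintegral_biUnion_finset]
    · refine lintegral_mono_set ?_
      exact iUnion₂_subset fun k hk => inter_subset_inter_left _ (hsub k hk)
    · intro k _ k' _ hkk'
      refine Set.disjoint_left.2 fun x hx hx' => hkk' (funext fun i => ?_)
      have : ∀ {k : Fin m → ℤ}, x ∈ latticeCube ℓ k → ⌊x i / ℓ⌋ = k i := by
        intro k hxk
        rw [Int.floor_eq_iff, le_div_iff₀ hℓ, div_lt_iff₀ hℓ]
        exact ⟨by linarith [(hxk i).1], by linarith [(hxk i).2]⟩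
      rw [← this hx.1, ← this hx'.1]
    · exact fun k _ => (measurableSet_latticeCube ℓ k).inter hU.measurableSet

end CubeEstimate

/-! ### The Gram matrix of a metric in charts. -/

section Charts

variable {m : ℕ} {X : Type*} [TopologicalSpace X] [ChartedSpace (Rm m) X]

theorem mdifferentiableAt_chart {φ : OpenPartialHomeomorph X (Rm m)}
    (hφ : φ ∈ IsManifold.maximalAtlas (𝓡 m) ∞ X) {q : X} (hq : q ∈ φ.source) :
    MDifferentiableAt (𝓡 m) (𝓡 m) φ q :=
  ((contMDiffOn_of_mem_maximalAtlas hφ).contMDiffAt (φ.open_source.mem_nhds hq)).mdifferentiableAt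
    (by simp)

theorem mdifferentiableAt_chart_symm {φ : OpenPartialHomeomorph X (Rm m)}
    (hφ : φ ∈ IsManifold.maximalAtlas (𝓡 m) ∞ X) {y : Rm m} (hy : y ∈ φ.target) :
    MDifferentiableAt (𝓡 m) (𝓡 m) φ.symm y :=
  ((contMDiffOn_symm_of_mem_maximalAtlas hφ).contMDiffAt
    (φ.open_target.mem_nhds hy)).mdifferentiableAt (by simp)

variable [IsManifold (𝓡 m) ∞ X]

theorem inner_mfderiv_symm_eq (h : SmoothMetric m X) {φ φ' : OpenPartialHomeomorph X (Rm m)}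
    (hφ : φ ∈ IsManifold.maximalAtlas (𝓡 m) ∞ X) (hφ' : φ' ∈ IsManifold.maximalAtlas (𝓡 m) ∞ X)
    {y : Rm m} (hy : y ∈ φ.target) (hy' : φ.symm y ∈ φ'.source) (a b : Rm m) :
    h.inner (φ.symm y) (mfderiv (𝓡 m) (𝓡 m) φ.symm y a) (mfderiv (𝓡 m) (𝓡 m) φ.symm y b) =
      h.inner (φ'.symm (φ' (φ.symm y)))
        (mfderiv (𝓡 m) (𝓡 m) φ'.symm (φ' (φ.symm y)) (fderiv ℝ (φ' ∘ φ.symm) y a : Rm m))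
        (mfderiv (𝓡 m) (𝓡 m) φ'.symm (φ' (φ.symm y)) (fderiv ℝ (φ' ∘ φ.symm) y b : Rm m)) := by
  have hev : φ.symm =ᶠ[𝓝 y] φ'.symm ∘ (φ' ∘ φ.symm) := by
    have hc : ContinuousAt φ.symm y := φ.symm.continuousAt hy
    filter_upwards [hc.preimage_mem_nhds (φ'.open_source.mem_nhds hy')] with z hz
    exact (φ'.left_inv hz).symm
  have hτ : MDifferentiableAt (𝓡 m) (𝓡 m) (φ' ∘ φ.symm) y :=
    MDifferentiableAt.comp y (mdifferentiableAt_chart hφ' hy') (mdifferentiableAt_chart_symm hφ hy)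
  have hd : ∀ c : Rm m, (mfderiv (𝓡 m) (𝓡 m) φ.symm y c : Rm m) =
      mfderiv (𝓡 m) (𝓡 m) φ'.symm (φ' (φ.symm y)) (fderiv ℝ (φ' ∘ φ.symm) y c : Rm m) := by
    intro c
    have h1 := hev.mfderiv_eq (I := 𝓡 m) (I' := 𝓡 m)
    have h2 := mfderiv_comp y (I'' := 𝓡 m)
      (mdifferentiableAt_chart_symm hφ' (φ'.map_source hy')) hτ
    rw [h1, h2, mfderiv_eq_fderiv]
    rfl
  -- The two base points are equal only propositionally, so the inner product is transported along
  -- that equality.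
  have hb : ∀ {q q' : X} (_ : q = q') (a b : Rm m), h.inner q (show TangentSpace (𝓡 m) q from a)
      (show TangentSpace (𝓡 m) q from b) = h.inner q' (show TangentSpace (𝓡 m) q' from a)
      (show TangentSpace (𝓡 m) q' from b) := by
    rintro q _ rfl a b; rfl
  refine (hb (φ'.left_inv hy').symm (mfderiv (𝓡 m) (𝓡 m) φ.symm y a)
    (mfderiv (𝓡 m) (𝓡 m) φ.symm y b)).trans ?_
  exact congrArg₂ (fun s t : Rm m => h.inner (φ'.symm (φ' (φ.symm y)))
    (show TangentSpace (𝓡 m) (φ'.symm (φ' (φ.symm y))) from s)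
    (show TangentSpace (𝓡 m) (φ'.symm (φ' (φ.symm y))) from t)) (hd a) (hd b)

theorem inner_mfderiv_symm_eq_sum (h : SmoothMetric m X) (φ : OpenPartialHomeomorph X (Rm m))
    (y a b : Rm m) :
    h.inner (φ.symm y) (mfderiv (𝓡 m) (𝓡 m) φ.symm y a) (mfderiv (𝓡 m) (𝓡 m) φ.symm y b) =
      ∑ k, ∑ l, a k * gram h φ y k l * b l := by
  have he : ∀ a : Rm m, a = ∑ i, a i • (EuclideanSpace.single i (1 : ℝ) : Rm m) := by
    intro a
    ext j
    simp [Finset.sum_apply, Pi.single_apply]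
  have hm : ∀ a : Rm m, mfderiv (𝓡 m) (𝓡 m) φ.symm y a = ∑ i, a i • coordVec φ y i := by
    intro a
    conv_lhs => rw [he a]
    exact (map_sum (mfderiv (𝓡 m) (𝓡 m) φ.symm y) _ _).trans
      (Finset.sum_congr rfl fun i _ => map_smul (mfderiv (𝓡 m) (𝓡 m) φ.symm y) _ _)
  rw [hm a, hm b]
  simp only [map_sum, map_smul, sum_apply, smul_apply,
    smul_eq_mul, gram, Matrix.of_apply]
  rw [Finset.sum_comm]
  refine Finset.sum_congr rfl fun k _ => ?_
  rw [Finset.mul_sum]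
  refine Finset.sum_congr rfl fun l _ => ?_
  ring

theorem gram_posDef (h : SmoothMetric m X) {φ : OpenPartialHomeomorph X (Rm m)}
    (hφ : φ ∈ IsManifold.maximalAtlas (𝓡 m) ∞ X) {y : Rm m} (hy : y ∈ φ.target) :
    (gram h φ y).PosDef := by
  refine Matrix.PosDef.of_dotProduct_mulVec_pos ?_ ?_
  · ext i j
    simp [gram, h.symm _ (coordVec φ y i)]
  · intro x hx
    have h1 := inner_mfderiv_symm_eq_sum h φ y (WithLp.toLp 2 x) (WithLp.toLp 2 x)
    have h2 : star x ⬝ᵥ (gram h φ y).mulVec x = ∑ k, ∑ l, x k * gram h φ y k l * x l := by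
      simp only [dotProduct, Matrix.mulVec, Pi.star_apply, star_trivial, Finset.mul_sum, mul_assoc]
    rw [h2, ← h1]
    refine h.pos _ _ fun h0 => hx ?_
    -- The differential of the inverse chart has a left inverse, so a vector with nonzero
    -- coordinates is nonzero.
    have h3 : (mfderiv (𝓡 m) (𝓡 m) φ (φ.symm y)).comp (mfderiv (𝓡 m) (𝓡 m) φ.symm y)
        = ContinuousLinearMap.id ℝ (Rm m) := by
      have hc := mfderiv_comp y (I'' := 𝓡 m) (mdifferentiableAt_chart hφ (φ.map_target hy))
        (mdifferentiableAt_chart_symm hφ hy)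
      have hid : φ ∘ φ.symm =ᶠ[𝓝 y] id := by
        filter_upwards [φ.open_target.mem_nhds hy] with z hz
        exact φ.right_inv hz
      rw [hid.mfderiv_eq, mfderiv_id] at hc
      exact hc.symm
    have h4 := congrArg (fun L : Rm m →L[ℝ] Rm m => L (WithLp.toLp 2 x)) h3
    simp only [ContinuousLinearMap.id_apply] at h4
    have h5 : (WithLp.toLp 2 x : Rm m) = 0 := by
      rw [← h4]
      exact (congrArg (mfderiv (𝓡 m) (𝓡 m) φ (φ.symm y)) h0).trans (map_zero _)
    simpa using h5

/-- Gram matrices in two charts are congruent by the Jacobian matrix of the transition map, so their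
determinants differ by the square of the Jacobian determinant. -/
theorem sqrt_det_gram_eq (h : SmoothMetric m X) {φ φ' : OpenPartialHomeomorph X (Rm m)}
    (hφ : φ ∈ IsManifold.maximalAtlas (𝓡 m) ∞ X) (hφ' : φ' ∈ IsManifold.maximalAtlas (𝓡 m) ∞ X)
    {y : Rm m} (hy : y ∈ φ.target) (hy' : φ.symm y ∈ φ'.source) :
    √(gram h φ y).det = |(fderiv ℝ (φ' ∘ φ.symm) y).det| *
      √(gram h φ' (φ' (φ.symm y))).det := by
  set L := fderiv ℝ (φ' ∘ φ.symm) y with hL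
  set J : Matrix (Fin m) (Fin m) ℝ :=
    Matrix.of fun k i => L (EuclideanSpace.single i (1 : ℝ)) k with hJ
  have h1 : gram h φ y = J.transpose * gram h φ' (φ' (φ.symm y)) * J := by
    ext i j
    have := inner_mfderiv_symm_eq h hφ hφ' hy hy' (EuclideanSpace.single i (1 : ℝ))
      (EuclideanSpace.single j (1 : ℝ))
    have := this.trans (inner_mfderiv_symm_eq_sum h φ' _ _ _)
    simp only [Matrix.mul_apply, Matrix.transpose_apply, Finset.sum_mul]
    rw [Finset.sum_comm]
    exact this
  have h2 : L.det = J.det := by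
    have : J = LinearMap.toMatrix (EuclideanSpace.basisFun (Fin m) ℝ).toBasis
        (EuclideanSpace.basisFun (Fin m) ℝ).toBasis (L : Rm m →ₗ[ℝ] Rm m) := by
      ext k i
      simp [hJ, LinearMap.toMatrix_apply]
    rw [this, LinearMap.det_toMatrix]
  rw [h1, Matrix.det_mul, Matrix.det_mul, Matrix.det_transpose, h2,
    show J.det * (gram h φ' (φ' (φ.symm y))).det * J.det
      = J.det ^ 2 * (gram h φ' (φ' (φ.symm y))).det by ring,
    Real.sqrt_mul (sq_nonneg _), Real.sqrt_sq_eq_abs]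

theorem continuousOn_gram (h : SmoothMetric m X) {φ : OpenPartialHomeomorph X (Rm m)}
    (hφ : φ ∈ IsManifold.maximalAtlas (𝓡 m) ∞ X) : ContinuousOn (gram h φ) φ.target := by
  -- A coordinate vector field is the tangent map of the inverse chart applied to a constant field,
  -- hence a continuous section along the inverse chart.
  have hsec : ∀ i : Fin m, ContMDiffOn (𝓡 m) (𝓡 m).tangent 0
      (fun y => (⟨φ.symm y, coordVec φ y i⟩ : TangentBundle (𝓡 m) X)) φ.target := by
    intro i
    have h1 := (contMDiffOn_symm_of_mem_maximalAtlas hφ).contMDiffOn_tangentMapWithin (m := 0)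
      (by simp) φ.open_target.uniqueMDiffOn
    have h2 : ContMDiff (𝓡 m) (𝓡 m).tangent 0
        (fun y : Rm m => (⟨y, EuclideanSpace.single i (1 : ℝ)⟩ : TangentBundle (𝓡 m) (Rm m))) := by
      rw [contMDiff_zero_iff]
      exact (tangentBundleModelSpaceHomeomorph (𝓡 m)).symm.continuous.comp
        (continuous_id.prodMk continuous_const)
    refine (h1.comp h2.contMDiffOn (fun y hy => hy)).congr fun y hy => ?_
    simp only [Function.comp, tangentMapWithin, coordVec]
    rw [mfderivWithin_of_isOpen φ.open_target hy]
  have hc : ∀ i j, ContinuousOn (fun y => gram h φ y i j) φ.target := by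
    intro i j
    have h1 : ContMDiffOn (𝓡 m) ((𝓡 m).prod 𝓘(ℝ)) 0
      (fun y ↦ Bundle.TotalSpace.mk' ℝ (E := Bundle.Trivial X ℝ) (φ.symm y)
        (h.inner (φ.symm y) (coordVec φ y i) (coordVec φ y j))) φ.target := by
      apply ContMDiffOn.clm_bundle_apply₂ (F₁ := Rm m) (F₂ := Rm m)
      · exact (h.contMDiff.of_le (by simp)).comp_contMDiffOn
          ((contMDiffOn_symm_of_mem_maximalAtlas hφ).of_le (by simp))
      · exact hsec i
      · exact hsec j
    have h2 := fun y hy => ((Bundle.contMDiffWithinAt_totalSpace).1 (h1 y hy)).2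
    exact fun y hy => (h2 y hy).continuousWithinAt
  exact continuousOn_pi.2 fun i => continuousOn_pi.2 fun j => hc i j

end Charts

/-! ### The Riemannian measure in charts. -/

section Volume

theorem OpenPartialHomeomorph.measurableSet_target_inter_preimage {X Y : Type*} [TopologicalSpace X]
    [TopologicalSpace Y] [MeasurableSpace X] [BorelSpace X] [MeasurableSpace Y] [BorelSpace Y]
    (φ : OpenPartialHomeomorph X Y) {A : Set X} (hA : MeasurableSet A) :
    MeasurableSet (φ.target ∩ φ.symm ⁻¹' A) := by
  have h1 : Measurable (φ.target.domRestrict φ.symm) :=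
    (continuousOn_iff_continuous_domRestrict.1 φ.continuousOn_symm).measurable
  have h2 := φ.open_target.measurableSet.subtype_image (h1 hA)
  convert h2 using 1
  ext y
  simp [and_comm]

variable {m : ℕ} {X : Type*} [TopologicalSpace X] [ChartedSpace (Rm m) X]
  [IsManifold (𝓡 m) ∞ X]

/-- The density of the Riemannian measure in the chart `φ`. -/
noncomputable def volumeDensity (h : SmoothMetric m X) (φ : OpenPartialHomeomorph X (Rm m))
    (y : Rm m) : ℝ≥0∞ := ENNReal.ofReal √(gram h φ y).det

theorem aemeasurable_volumeDensity (h : SmoothMetric m X) {φ : OpenPartialHomeomorph X (Rm m)}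
    (hφ : φ ∈ IsManifold.maximalAtlas (𝓡 m) ∞ X) :
    AEMeasurable (volumeDensity h φ) (volume.restrict φ.target) := by
  have h1 : ContinuousOn (fun y => (gram h φ y).det) φ.target :=
    (Continuous.matrix_det continuous_id).comp_continuousOn (continuousOn_gram h hφ)
  exact ((Real.continuous_sqrt.comp_continuousOn h1).aemeasurable
    φ.open_target.measurableSet).ennreal_ofReal

/-- Cauchy–Schwarz, read off from the discriminant of t ↦ |Z + t ∂ᵢ|². -/
theorem sq_inner_coordVec_le (h : SmoothMetric m X) (φ : OpenPartialHomeomorph X (Rm m)) (y : Rm m)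
    (i : Fin m) (Z : TangentSpace (𝓡 m) (φ.symm y)) :
    h.inner (φ.symm y) Z (coordVec φ y i) ^ 2 ≤
      h.inner (φ.symm y) Z Z * gram h φ y i i := by
  set B := h.inner (φ.symm y) with hB
  set e := coordVec φ y i with he
  have hnn : ∀ v, 0 ≤ B v v := by
    intro v
    by_cases hv : v = 0
    · simp [hv]
    · exact (h.pos _ v hv).le
  have hq : ∀ t : ℝ, 0 ≤ B e e * (t * t) + 2 * B Z e * t + B Z Z := by
    intro t
    have h1 := hnn (Z + t • e)
    simp only [map_add, map_smul, add_apply, smul_apply, smul_eq_mul] at h1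
    have h2 : B e Z = B Z e := h.symm _ _ _
    rw [h2] at h1
    linarith
  have := discrim_le_zero hq
  simp only [discrim] at this
  have hg : gram h φ y i i = B e e := rfl
  rw [hg]
  nlinarith

variable [MeasurableSpace X]

theorem chartVolume_le_riemVolume (h : SmoothMetric m X) {φ : OpenPartialHomeomorph X (Rm m)}
    (hφ : φ ∈ IsManifold.maximalAtlas (𝓡 m) ∞ X) : chartVolume h φ ≤ riemVolume h :=
  le_iSup₂ (f := fun φ (_ : φ ∈ IsManifold.maximalAtlas (𝓡 m) ∞ X) => chartVolume h φ) φ hφ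

variable [BorelSpace X]

/-- F is not assumed measurable, since it will be |Z|² for an arbitrary weak gradient field Z. For
such F a pushforward gives only an inequality; pushing forward by the inverse chart and back by the
chart gives both directions. -/
theorem lintegral_chartVolume (h : SmoothMetric m X) {φ : OpenPartialHomeomorph X (Rm m)}
    (hφ : φ ∈ IsManifold.maximalAtlas (𝓡 m) ∞ X) (F : X → ℝ≥0∞) :
    ∫⁻ q, F q ∂chartVolume h φ = ∫⁻ y in φ.target, volumeDensity h φ y * F (φ.symm y) := by
  set ν := (volume.restrict φ.target).withDensity (volumeDensity h φ) with hν
  have hcv : chartVolume h φ = ν.map φ.symm := rfl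
  have hac : ν ≪ volume.restrict φ.target := withDensity_absolutelyContinuous _ _
  have hm : AEMeasurable φ.symm ν :=
    (φ.continuousOn_symm.aemeasurable φ.open_target.measurableSet).mono_ac hac
  have h1 : ∫⁻ y, F (φ.symm y) ∂ν = ∫⁻ y in φ.target, volumeDensity h φ y * F (φ.symm y) :=
    lintegral_withDensity_eq_lintegral_mul_non_measurable₀ _ (aemeasurable_volumeDensity h hφ)
      (Eventually.of_forall fun y => ENNReal.ofReal_lt_top) _
  rw [hcv, ← h1]
  have hsrc : ∀ᵐ q ∂ν.map φ.symm, q ∈ φ.source := by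
    rw [ae_map_iff (p := (· ∈ φ.source)) hm φ.open_source.measurableSet]
    exact hac (by
      filter_upwards [ae_restrict_mem φ.open_target.measurableSet] with y hy
      exact φ.map_target hy)
  refine le_antisymm (lintegral_map_le _ _) ?_
  have hφm : AEMeasurable φ (ν.map φ.symm) := by
    have : ν.map φ.symm = (ν.map φ.symm).restrict φ.source :=
      (Measure.restrict_eq_self_of_ae_mem hsrc).symm
    rw [this]
    exact φ.continuousOn.aemeasurable φ.open_source.measurableSet
  have hback : (ν.map φ.symm).map φ = ν := by
    rw [AEMeasurable.map_map_of_aemeasurable hφm hm]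
    have : φ ∘ φ.symm =ᵐ[ν] id := hac (by
      filter_upwards [ae_restrict_mem φ.open_target.measurableSet] with y hy
      exact φ.right_inv hy)
    rw [Measure.map_congr this, Measure.map_id]
  calc ∫⁻ y, F (φ.symm y) ∂ν = ∫⁻ y, F (φ.symm y) ∂((ν.map φ.symm).map φ) := by rw [hback]
    _ ≤ ∫⁻ q, F (φ.symm (φ q)) ∂(ν.map φ.symm) := lintegral_map_le _ _
    _ = ∫⁻ q, F q ∂(ν.map φ.symm) := by
        refine lintegral_congr_ae ?_
        filter_upwards [hsrc] with q hq
        rw [φ.left_inv hq]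

theorem chartVolume_apply (h : SmoothMetric m X) {φ : OpenPartialHomeomorph X (Rm m)}
    (hφ : φ ∈ IsManifold.maximalAtlas (𝓡 m) ∞ X) {A : Set X} (hA : MeasurableSet A) :
    chartVolume h φ A = ∫⁻ y in φ.target ∩ φ.symm ⁻¹' A, volumeDensity h φ y := by
  have hS := φ.measurableSet_target_inter_preimage hA
  rw [← lintegral_indicator_one hA, lintegral_chartVolume h hφ]
  conv_rhs => rw [← inter_eq_left.2 (inter_subset_left (s := φ.target) (t := φ.symm ⁻¹' A)),
    ← setLIntegral_indicator hS]
  refine setLIntegral_congr_fun φ.open_target.measurableSet fun y hy => ?_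
  by_cases hyA : φ.symm y ∈ A
  · simp [hyA, hy]
  · simp [hyA]

theorem chartVolume_eq_of_subset (h : SmoothMetric m X) {φ φ' : OpenPartialHomeomorph X (Rm m)}
    (hφ : φ ∈ IsManifold.maximalAtlas (𝓡 m) ∞ X) (hφ' : φ' ∈ IsManifold.maximalAtlas (𝓡 m) ∞ X)
    {A : Set X} (hA : MeasurableSet A) (hs : A ⊆ φ.source) (hs' : A ⊆ φ'.source) :
    chartVolume h φ A = chartVolume h φ' A := by
  rw [chartVolume_apply h hφ hA, chartVolume_apply h hφ' hA]
  set S := φ.target ∩ φ.symm ⁻¹' A with hS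
  have himg : φ'.target ∩ φ'.symm ⁻¹' A = (φ' ∘ φ.symm) '' S := by
    ext z
    constructor
    · rintro ⟨hz, hzA⟩
      refine ⟨φ (φ'.symm z), ⟨φ.map_source (hs hzA), ?_⟩, ?_⟩
      · rw [mem_preimage, φ.left_inv (hs hzA)]; exact hzA
      · simp [φ.left_inv (hs hzA), φ'.right_inv hz]
    · rintro ⟨y, ⟨_, hyA⟩, rfl⟩
      refine ⟨φ'.map_source (hs' hyA), ?_⟩
      rw [mem_preimage, Function.comp, φ'.left_inv (hs' hyA)]; exact hyA
  have hinj : InjOn (φ' ∘ φ.symm) S := by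
    rintro y ⟨hy, hyA⟩ z ⟨hz, hzA⟩ hyz
    have := φ'.injOn (hs' hyA) (hs' hzA) hyz
    exact φ.symm.injOn hy hz this
  have hder : ∀ y ∈ S, HasFDerivWithinAt (φ' ∘ φ.symm) (fderiv ℝ (φ' ∘ φ.symm) y) S y := by
    rintro y ⟨hy, hyA⟩
    have hτ : MDifferentiableAt (𝓡 m) (𝓡 m) (φ' ∘ φ.symm) y :=
      MDifferentiableAt.comp y (mdifferentiableAt_chart hφ' (hs' hyA))
        (mdifferentiableAt_chart_symm hφ hy)
    exact (mdifferentiableAt_iff_differentiableAt.1 hτ).hasFDerivAt.hasFDerivWithinAt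
  have hSm : MeasurableSet S := φ.measurableSet_target_inter_preimage hA
  rw [himg, lintegral_image_eq_lintegral_abs_det_fderiv_mul volume hSm hder hinj]
  refine setLIntegral_congr_fun hSm fun y hy => ?_
  simp only [volumeDensity]
  rw [← ENNReal.ofReal_mul (abs_nonneg _), sqrt_det_gram_eq h hφ hφ' hy.1 (hs' hy.2)]
  rfl

/-- A supremum of measures is bounded one chart at a time, and on each piece of the cover any two
chart volumes agree. This inequality lets a finite cover replace all charts. -/
theorem riemVolume_le_sum {ι : Type*} (T : Finset ι) (h : SmoothMetric m X)
    (φ : ι → OpenPartialHomeomorph X (Rm m))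
    (hφ : ∀ j ∈ T, φ j ∈ IsManifold.maximalAtlas (𝓡 m) ∞ X) {A : ι → Set X}
    (hA : ∀ j ∈ T, MeasurableSet (A j)) (hs : ∀ j ∈ T, A j ⊆ (φ j).source)
    (hcov : ⋃ j ∈ T, A j = univ) :
    riemVolume h ≤ ∑ j ∈ T, (chartVolume h (φ j)).restrict (A j) := by
  refine iSup₂_le fun ψ hψ => Measure.le_iff.2 fun S hS => ?_
  have h0 : chartVolume h ψ S = chartVolume h ψ (S ∩ ψ.source) := by
    rw [chartVolume_apply h hψ hS, chartVolume_apply h hψ (hS.inter ψ.open_source.measurableSet)]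
    congr 2
    ext y
    simp only [mem_inter_iff, mem_preimage, and_congr_right_iff]
    exact fun hy => ⟨fun h' => ⟨h', ψ.map_target hy⟩, fun h' => h'.1⟩
  have hcov' : S ∩ ψ.source ⊆ ⋃ j ∈ T, (S ∩ ψ.source ∩ A j) := by
    rw [← inter_iUnion₂, hcov, inter_univ]
  rw [h0, Measure.finsetSum_apply]
  refine (measure_mono hcov').trans ((measure_biUnion_finset_le T _).trans ?_)
  refine Finset.sum_le_sum fun j hj => ?_
  rw [chartVolume_eq_of_subset h hψ (hφ j hj)
    ((hS.inter ψ.open_source.measurableSet).inter (hA j hj))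
    (inter_subset_left.trans inter_subset_right) (inter_subset_right.trans (hs j hj)),
    Measure.restrict_apply hS]
  exact measure_mono (inter_subset_inter_left _ inter_subset_left)

end Volume

/-! ### Relative compactness by finite-dimensional approximation. -/

section Compactness

/-- Bounded sets in a finite-dimensional subspace are totally bounded, and total boundedness
survives a uniform perturbation by ε/3. -/
theorem isCompact_closure_of_finiteDimensional_approx {E : Type*} [NormedAddCommGroup E]
    [NormedSpace ℝ E] [CompleteSpace E] {S : Set E} {R : ℝ} (hR : ∀ u ∈ S, ‖u‖ ≤ R)
    (h : ∀ η : ℝ, 0 < η → ∃ V : Submodule ℝ E, FiniteDimensional ℝ V ∧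
      ∀ u ∈ S, ∃ v ∈ V, ‖u - v‖ ≤ η) : IsCompact (closure S) := by
  refine isCompact_iff_totallyBounded_isComplete.2
    ⟨TotallyBounded.closure ?_, isClosed_closure.isComplete⟩
  rw [Metric.totallyBounded_iff]
  intro ε hε
  obtain ⟨V, hV, hVS⟩ := h (ε / 3) (by positivity)
  have : ProperSpace V := FiniteDimensional.proper ℝ V
  have hK : IsCompact ((↑) '' Metric.closedBall (0 : V) (R + ε / 3) : Set E) :=
    (isCompact_closedBall _ _).image continuous_subtype_val
  obtain ⟨t, ht, hcov⟩ := Metric.totallyBounded_iff.1 hK.totallyBounded (ε / 3) (by positivity)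
  refine ⟨t, ht, fun u hu => ?_⟩
  obtain ⟨v, hv, huv⟩ := hVS u hu
  have hvK : v ∈ ((↑) '' Metric.closedBall (0 : V) (R + ε / 3) : Set E) := by
    refine ⟨⟨v, hv⟩, ?_, rfl⟩
    rw [mem_closedBall_zero_iff]
    calc ‖v‖ = ‖u - (u - v)‖ := by congr 1; abel
      _ ≤ ‖u‖ + ‖u - v‖ := norm_sub_le _ _
      _ ≤ R + ε / 3 := add_le_add (hR u hu) huv
  obtain ⟨y, hy, hvy⟩ := mem_iUnion₂.1 (hcov hvK)
  refine mem_iUnion₂.2 ⟨y, hy, ?_⟩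
  rw [Metric.mem_ball] at hvy ⊢
  calc dist u y ≤ dist u v + dist v y := dist_triangle _ _ _
    _ < ε := by rw [dist_eq_norm u v]; linarith

theorem exists_disjoint_refinement {ι α : Type*} [MeasurableSpace α] (T : Finset ι)
    {A : ι → Set α} (hA : ∀ i ∈ T, MeasurableSet (A i)) :
    ∃ A' : ι → Set α, (∀ i ∈ T, MeasurableSet (A' i)) ∧ (∀ i ∈ T, A' i ⊆ A i) ∧
      (T : Set ι).PairwiseDisjoint A' ∧ ⋃ i ∈ T, A' i = ⋃ i ∈ T, A i := by
  classical
  induction T using Finset.induction_on with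
  | empty => exact ⟨A, by simp⟩
  | insert a T ha ih =>
    obtain ⟨A', h1, h2, h3, h4⟩ := ih fun i hi => hA i (Finset.mem_insert_of_mem hi)
    have hne : ∀ i ∈ T, i ≠ a := fun i hi h => ha (h ▸ hi)
    refine ⟨Function.update A' a (A a \ ⋃ i ∈ T, A i), ?_, ?_, ?_, ?_⟩
    · intro i hi
      rcases Finset.mem_insert.1 hi with rfl | hi
      · rw [Function.update_self]
        exact (hA i (Finset.mem_insert_self _ _)).diff
          (T.measurableSet_biUnion fun j hj => hA j (Finset.mem_insert_of_mem hj))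
      · rw [Function.update_of_ne (hne i hi)]; exact h1 i hi
    · intro i hi
      rcases Finset.mem_insert.1 hi with rfl | hi
      · rw [Function.update_self]; exact sdiff_subset
      · rw [Function.update_of_ne (hne i hi)]; exact h2 i hi
    · rw [Finset.coe_insert]
      refine Set.PairwiseDisjoint.insert ?_ ?_
      · intro i hi j hj hij
        simp only [Function.onFun, Function.update_of_ne (hne i hi),
          Function.update_of_ne (hne j hj)]
        exact h3 hi hj hij
      · intro j hj _
        rw [Function.update_self, Function.update_of_ne (hne j hj)]
        refine Set.disjoint_left.2 fun x hx hx' => hx.2 ?_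
        exact mem_iUnion₂.2 ⟨j, hj, h2 j hj hx'⟩
    · rw [Finset.set_biUnion_insert, Finset.set_biUnion_insert, Function.update_self]
      have : ⋃ x ∈ T, Function.update A' a (A a \ ⋃ i ∈ T, A i) x = ⋃ i ∈ T, A i := by
        rw [← h4]
        exact iUnion₂_congr fun i hi => by rw [Function.update_of_ne (hne i hi)]
      rw [this, sdiff_union_self]

theorem MeasureTheory.Lp.norm_sub_le_of_lintegral_sq_le {α : Type*} [MeasurableSpace α]
    {μ : Measure α} (u v : Lp ℝ 2 μ) {η : ℝ} (hη : 0 ≤ η)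
    (h : ∫⁻ x, ENNReal.ofReal ((u x - v x) ^ 2) ∂μ ≤ ENNReal.ofReal (η ^ 2)) : ‖u - v‖ ≤ η := by
  rw [Lp.norm_def]
  refine ENNReal.toReal_le_of_le_ofReal hη ?_
  rw [eLpNorm_congr_ae (Lp.coeFn_sub u v), eLpNorm_eq_lintegral_rpow_enorm_toReal (by simp) (by simp)]
  have : ∀ x, ‖(u - v : α → ℝ) x‖ₑ ^ (2 : ℝ≥0∞).toReal = ENNReal.ofReal ((u x - v x) ^ 2) := by
    intro x
    rw [Pi.sub_apply, ← ofReal_norm, ENNReal.toReal_ofNat, ENNReal.rpow_two,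
      ← ENNReal.ofReal_pow (norm_nonneg _), Real.norm_eq_abs, sq_abs]
  simp_rw [this]
  calc _ ≤ (ENNReal.ofReal (η ^ 2)) ^ (1 / (2 : ℝ≥0∞).toReal) := by gcongr
    _ = ENNReal.ofReal η := by
      rw [ENNReal.ofReal_pow hη, ← ENNReal.rpow_two, ← ENNReal.rpow_mul]
      simp

theorem exists_finiteDimensional_indicator {α : Type*} [MeasurableSpace α] {μ : Measure α}
    [IsFiniteMeasure μ] {ι : Type*} (T : Finset ι) {A : ι → Set α}
    (hA : ∀ i ∈ T, MeasurableSet (A i)) :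
    ∃ V : Submodule ℝ (Lp ℝ 2 μ), FiniteDimensional ℝ V ∧
      ∀ c : ι → ℝ, ∃ v ∈ V, v =ᵐ[μ] fun x => ∑ i ∈ T, (A i).indicator (fun _ => c i) x := by
  classical
  set b : T → Lp ℝ 2 μ := fun i =>
    indicatorConstLp 2 (hA i i.2) (measure_ne_top μ _) (1 : ℝ) with hb
  refine ⟨Submodule.span ℝ (range b), FiniteDimensional.span_of_finite ℝ (finite_range b),
    fun c => ⟨∑ i : T, c i • b i, ?_, ?_⟩⟩
  · exact Submodule.sum_mem _ fun i _ =>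
      Submodule.smul_mem _ _ (Submodule.subset_span (mem_range_self i))
  · have h1 : ∀ i : T, ∀ᵐ x ∂μ, (c i • b i : Lp ℝ 2 μ) x = (A i).indicator (fun _ => c i) x := by
      intro i
      filter_upwards [Lp.coeFn_smul (c i) (b i),
        indicatorConstLp_coeFn (p := 2) (hs := hA i i.2) (hμs := measure_ne_top μ _)
          (c := (1 : ℝ))] with x hx1 hx2
      rw [hx1, Pi.smul_apply, hx2]
      by_cases hx : x ∈ A i <;> simp [hx]
    filter_upwards [Lp.coeFn_fun_finsetSum Finset.univ fun i : T => c i • b i,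
      ae_all_iff.2 h1] with x hx hx1
    rw [hx, Finset.sum_congr rfl fun i _ => hx1 i]
    exact Finset.sum_coe_sort T fun i => (A i).indicator (fun _ => c i) x

end Compactness

/-! ### From admissible balls to the compact inclusion. -/

section LocalToGlobal

variable {m : ℕ} {X : Type*} [TopologicalSpace X] [ChartedSpace (Rm m) X]
  [IsManifold (𝓡 m) ∞ X]

/-- A chart `ψ` with a ball of radius `2 r` around `y`, on which the volume density has a high enough
integrability exponent and dominates the trace of the metric, and in which almost all segments
stay in the target of the chart. -/
structure IsAdmissibleBall (h : SmoothMetric m X) (ψ : OpenPartialHomeomorph X (Rm m)) (y : Rm m)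
    (r : ℝ) : Prop where
  mem_maximalAtlas : ψ ∈ IsManifold.maximalAtlas (𝓡 m) ∞ X
  radius_pos : 0 < r
  exists_exponent : ∃ q : ℝ, 1 < q ∧ m < 2 * q ∧
    ∫⁻ x in Metric.closedBall y (2 * r) ∩ ψ.target, volumeDensity h ψ x ^ q ≠ ⊤
  ae_segment : ∀ᵐ x, ∀ᵐ z, x ∈ Metric.closedBall y (2 * r) → z ∈ Metric.closedBall y (2 * r) →
    ∀ t ∈ Icc (0 : ℝ) 1, x + t • (z - x) ∈ ψ.target
  exists_trace_le : ∃ C : ℝ≥0∞, C ≠ ⊤ ∧ ∀ x ∈ Metric.closedBall y (2 * r) ∩ ψ.target,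
    ENNReal.ofReal (∑ i, gram h ψ x i i) ≤ C * volumeDensity h ψ x

theorem gradSq_inner_coordVec_le (h : SmoothMetric m X) (ψ : OpenPartialHomeomorph X (Rm m))
    (Z : ∀ q : X, TangentSpace (𝓡 m) q) (y : Rm m) :
    gradSq (fun i y => h.inner (ψ.symm y) (Z (ψ.symm y)) (coordVec ψ y i)) y ≤
      ENNReal.ofReal (h.inner (ψ.symm y) (Z (ψ.symm y)) (Z (ψ.symm y))) *
        ENNReal.ofReal (∑ i, gram h ψ y i i) := by
  have hnn : ∀ v, 0 ≤ h.inner (ψ.symm y) v v := by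
    intro v
    by_cases hv : v = 0
    · simp [hv]
    · exact (h.pos _ v hv).le
  rw [← ENNReal.ofReal_mul (hnn _), gradSq, Finset.mul_sum]
  exact ENNReal.ofReal_le_ofReal (Finset.sum_le_sum fun i _ => sq_inner_coordVec_le h ψ y i _)

theorem isWeakGradient_hasWeakPartials {h : SmoothMetric m X} {u : X → ℝ}
    {Z : ∀ q : X, TangentSpace (𝓡 m) q} (hZ : IsWeakGradient h u Z)
    {ψ : OpenPartialHomeomorph X (Rm m)} (hψ : ψ ∈ IsManifold.maximalAtlas (𝓡 m) ∞ X) :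
    HasWeakPartials ψ.target (fun y => u (ψ.symm y))
      (fun i y => h.inner (ψ.symm y) (Z (ψ.symm y)) (coordVec ψ y i)) :=
  hZ ψ hψ

variable [MeasurableSpace X]

theorem exists_isWeakGradient_of_sobolevNorm_lt {h : SmoothMetric m X} {u : X → ℝ} {C : ℝ≥0∞}
    (hu : sobolevNorm h u < C) : ∃ Z, IsWeakGradient h u Z ∧
      (∫⁻ q, ENNReal.ofReal (u q ^ 2) ∂riemVolume h) +
        ∫⁻ q, ENNReal.ofReal (h.inner q (Z q) (Z q)) ∂riemVolume h ≤ C ^ 2 := by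
  simp only [sobolevNorm, iInf_lt_iff] at hu
  obtain ⟨Z, hZ, hlt⟩ := hu
  refine ⟨Z, hZ, ?_⟩
  have := pow_le_pow_left' hlt.le 2
  rwa [← ENNReal.rpow_natCast, ← ENNReal.rpow_mul, show (1 / 2 : ℝ) * ((2 : ℕ) : ℝ) = 1 by norm_num,
    ENNReal.rpow_one] at this

variable [BorelSpace X]

theorem setLIntegral_chartVolume (h : SmoothMetric m X) {ψ : OpenPartialHomeomorph X (Rm m)}
    (hψ : ψ ∈ IsManifold.maximalAtlas (𝓡 m) ∞ X) {P : Set (Rm m)} (hP : MeasurableSet P)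
    (F : X → ℝ≥0∞) :
    ∫⁻ q in ψ.source ∩ ψ ⁻¹' P, F q ∂chartVolume h ψ =
      ∫⁻ y in P ∩ ψ.target, volumeDensity h ψ y * F (ψ.symm y) := by
  have hA : MeasurableSet (ψ.source ∩ ψ ⁻¹' P) := ψ.symm.measurableSet_target_inter_preimage hP
  rw [← lintegral_indicator hA, lintegral_chartVolume h hψ, ← setLIntegral_indicator hP]
  refine setLIntegral_congr_fun ψ.open_target.measurableSet fun y hy => ?_
  have hs := ψ.map_target hy
  have hr := ψ.right_inv hy
  by_cases hyP : y ∈ P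
  · have : ψ.symm y ∈ ψ.source ∩ ψ ⁻¹' P := ⟨hs, by rwa [mem_preimage, hr]⟩
    simp only [indicator_of_mem this, indicator_of_mem hyP]
  · have : ψ.symm y ∉ ψ.source ∩ ψ ⁻¹' P := fun h' => hyP (by have := h'.2; rwa [mem_preimage, hr] at this)
    simp only [indicator_of_notMem this, indicator_of_notMem hyP, mul_zero]

/-- The Dirichlet integral in an admissible ball is controlled by the Riemannian one. -/
theorem lintegral_gradSq_le {h : SmoothMetric m X} {ψ : OpenPartialHomeomorph X (Rm m)}
    (hψ : ψ ∈ IsManifold.maximalAtlas (𝓡 m) ∞ X) {B : Set (Rm m)} (hB : MeasurableSet B)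
    {C : ℝ≥0∞} (hC : C ≠ ⊤)
    (htr : ∀ x ∈ B ∩ ψ.target, ENNReal.ofReal (∑ i, gram h ψ x i i) ≤ C * volumeDensity h ψ x)
    (Z : ∀ q : X, TangentSpace (𝓡 m) q) :
    ∫⁻ y in B ∩ ψ.target,
        gradSq (fun i y => h.inner (ψ.symm y) (Z (ψ.symm y)) (coordVec ψ y i)) y ≤
      C * ∫⁻ q, ENNReal.ofReal (h.inner q (Z q) (Z q)) ∂riemVolume h := by
  calc ∫⁻ y in B ∩ ψ.target,
        gradSq (fun i y => h.inner (ψ.symm y) (Z (ψ.symm y)) (coordVec ψ y i)) y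
      ≤ ∫⁻ y in B ∩ ψ.target, C * (volumeDensity h ψ y *
          ENNReal.ofReal (h.inner (ψ.symm y) (Z (ψ.symm y)) (Z (ψ.symm y)))) := by
        refine setLIntegral_mono' (hB.inter ψ.open_target.measurableSet) fun y hy => ?_
        refine (gradSq_inner_coordVec_le h ψ Z y).trans ?_
        rw [← mul_assoc, mul_comm]
        gcongr
        exact htr y hy
    _ = C * ∫⁻ q in ψ.source ∩ ψ ⁻¹' B, ENNReal.ofReal (h.inner q (Z q) (Z q)) ∂chartVolume h ψ := by
        rw [lintegral_const_mul' _ _ hC, setLIntegral_chartVolume h hψ hB]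
    _ ≤ _ := by
        refine mul_le_mul' le_rfl ((setLIntegral_le_lintegral _ _).trans
          (lintegral_mono' (chartVolume_le_riemVolume h hψ) le_rfl))

theorem chartVolume_admissibleBall_ne_top {h : SmoothMetric m X}
    {ψ : OpenPartialHomeomorph X (Rm m)} {y : Rm m} {r : ℝ} (hb : IsAdmissibleBall h ψ y r) :
    chartVolume h ψ (ψ.source ∩ ψ ⁻¹' Metric.closedBall y (2 * r)) ≠ ⊤ := by
  obtain ⟨q, hq, -, hfin⟩ := hb.exists_exponent
  have h1 := setLIntegral_chartVolume h hb.mem_maximalAtlas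
    (P := Metric.closedBall y (2 * r)) Metric.isClosed_closedBall.measurableSet (fun _ => 1)
  rw [setLIntegral_one] at h1
  rw [h1]
  -- On a set of finite Lebesgue measure, a weight in L^q with q > 1 is integrable.
  have h2 : ∀ x : ℝ≥0∞, x * 1 ≤ 1 + x ^ q := by
    intro x
    rw [mul_one]
    rcases le_total x 1 with hx | hx
    · exact hx.trans le_self_add
    · calc x = x ^ (1 : ℝ) := (ENNReal.rpow_one x).symm
        _ ≤ x ^ q := ENNReal.rpow_le_rpow_of_exponent_le hx hq.le
        _ ≤ 1 + x ^ q := le_add_self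
  refine ne_top_of_le_ne_top ?_ (lintegral_mono fun x => h2 _)
  rw [lintegral_add_left measurable_const]
  refine ENNReal.add_ne_top.2 ⟨?_, hfin⟩
  rw [setLIntegral_one]
  exact ((measure_mono inter_subset_left).trans_lt
    (isCompact_closedBall y (2 * r)).measure_lt_top).ne

/-- In each ball the volume density plays the role of the weight, and the trace bound converts the
Euclidean Dirichlet integral into the Riemannian one. The cubes do not depend on u, only the
constants on them do, so all step functions lie in one finite-dimensional space. -/
theorem sobolevCompactlyIncluded_of_admissibleBalls (hm : 0 < m) (h : SmoothMetric m X) {ι : Type*}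
    (T : Finset ι) (ψ : ι → OpenPartialHomeomorph X (Rm m)) (y : ι → Rm m) (r : ι → ℝ)
    (hb : ∀ j ∈ T, IsAdmissibleBall h (ψ j) (y j) (r j))
    (hcov : ∀ q : X, ∃ j ∈ T, q ∈ (ψ j).source ∧ ψ j q ∈ Metric.closedBall (y j) (r j)) :
    SobolevCompactlyIncluded h := by
  classical
  intro S _ hSC
  obtain ⟨C, hC⟩ := hSC
  -- The norm is an infimum over weak gradients; the strict inequality obtained from the added 1
  -- yields an actual gradient.
  set C' : ℝ≥0∞ := (C : ℝ≥0∞) + 1 with hC'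
  have hlt : ∀ u ∈ S, sobolevNorm h u < C' := fun u hu =>
    (hC u hu).trans_lt (ENNReal.lt_add_right (by simp) (by simp))
  have hC'top : C' ≠ ⊤ := by simp [hC']
  have : IsFiniteMeasure (riemVolume h) := by
    have hle := riemVolume_le_sum T h ψ (fun j hj => (hb j hj).mem_maximalAtlas)
      (A := fun j => (ψ j).source ∩ ψ j ⁻¹' Metric.closedBall (y j) (2 * r j))
      (fun j _ => (ψ j).symm.measurableSet_target_inter_preimage
        Metric.isClosed_closedBall.measurableSet)
      (fun j _ => inter_subset_left) (by
        refine eq_univ_of_forall fun q => ?_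
        obtain ⟨j, hj, hqs, hqB⟩ := hcov q
        refine mem_iUnion₂.2 ⟨j, hj, hqs, Metric.closedBall_subset_closedBall ?_ hqB⟩
        linarith [(hb j hj).radius_pos])
    refine ⟨(hle univ).trans_lt ?_⟩
    rw [Measure.finsetSum_apply, ENNReal.sum_lt_top]
    intro j hj
    rw [Measure.restrict_apply_univ]
    exact (chartVolume_admissibleBall_ne_top (hb j hj)).lt_top
  refine isCompact_closure_of_finiteDimensional_approx (R := C'.toReal) ?_ ?_
  · intro u hu
    obtain ⟨Z, -, hZ⟩ := exists_isWeakGradient_of_sobolevNorm_lt (hlt u hu)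
    have h1 : ∫⁻ q, ENNReal.ofReal ((u q - (0 : Lp ℝ 2 (riemVolume h)) q) ^ 2) ∂riemVolume h
        ≤ ENNReal.ofReal (C'.toReal ^ 2) := by
      rw [ENNReal.ofReal_pow ENNReal.toReal_nonneg, ENNReal.ofReal_toReal hC'top]
      refine le_trans (le_of_eq ?_) (le_self_add.trans hZ)
      refine lintegral_congr_ae ?_
      filter_upwards [Lp.coeFn_zero ℝ 2 (riemVolume h)] with q hq
      rw [hq, Pi.zero_apply, sub_zero]
    simpa using Lp.norm_sub_le_of_lintegral_sq_le u 0 ENNReal.toReal_nonneg h1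
  · intro η hη
    have hex : ∀ j, ∃ (Tj : Finset (Fin m → ℤ)) (P : (Fin m → ℤ) → Set (Rm m)),
        j ∈ T → (∀ k, MeasurableSet (P k)) ∧ Metric.closedBall (y j) (r j) ⊆ ⋃ k ∈ Tj, P k ∧
        (∀ k ∈ Tj, P k ⊆ Metric.closedBall (y j) (2 * r j)) ∧
        ∀ {u : X → ℝ} {Z : ∀ q : X, TangentSpace (𝓡 m) q}, IsWeakGradient h u Z →
          (∫⁻ q, ENNReal.ofReal (h.inner q (Z q) (Z q)) ∂riemVolume h ≤ C' ^ 2) →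
          ∃ c : (Fin m → ℤ) → ℝ,
          ∑ k ∈ Tj, ∫⁻ x in P k ∩ (ψ j).target, volumeDensity h (ψ j) x *
            ENNReal.ofReal ((u ((ψ j).symm x) - c k) ^ 2) ≤
              ENNReal.ofReal (η ^ 2) / (T.card + 1) := by
      intro j
      by_cases hj : j ∈ T
      swap
      · exact ⟨∅, fun _ => ∅, fun h' => absurd h' hj⟩
      obtain ⟨q, hq, hmq, hfin⟩ := (hb j hj).exists_exponent
      obtain ⟨K, hK, htr⟩ := (hb j hj).exists_trace_le
      set ε : ℝ≥0∞ := ENNReal.ofReal (η ^ 2) / (T.card + 1) with hε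
      have hε0 : ε ≠ 0 := by
        rw [hε, Ne, ENNReal.div_eq_zero_iff, not_or]
        refine ⟨?_, ?_⟩
        · simp; positivity
        · exact ENNReal.add_ne_top.2 ⟨ENNReal.natCast_ne_top _, ENNReal.one_ne_top⟩
      -- The added 1 keeps the divisor nonzero, also for K = 0.
      have hx : K * C' ^ 2 + 1 ≠ ⊤ := by finiteness
      have hη' : ε / (K * C' ^ 2 + 1) ≠ 0 := by
        rw [Ne, ENNReal.div_eq_zero_iff, not_or]
        exact ⟨hε0, hx⟩
      obtain ⟨Tj, P, h1, h2, h3, h4⟩ := exists_finite_partition_lintegral_sq_sub_le hm hq hmq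
        (ψ j).open_target (aemeasurable_volumeDensity h (hb j hj).mem_maximalAtlas)
        (hb j hj).radius_pos hfin (hb j hj).ae_segment hη'
      refine ⟨Tj, P, fun _ => ⟨h1, h2, h3, fun {u Z} hZ hZC => ?_⟩⟩
      obtain ⟨c, hc⟩ := h4 (isWeakGradient_hasWeakPartials hZ (hb j hj).mem_maximalAtlas)
      refine ⟨c, ?_⟩
      simp_rw [mul_comm (volumeDensity h (ψ j) _)]
      refine hc.trans ?_
      calc _ ≤ ε / (K * C' ^ 2 + 1) * (K * C' ^ 2 + 1) := by
            gcongr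
            refine (lintegral_gradSq_le (hb j hj).mem_maximalAtlas
              Metric.isClosed_closedBall.measurableSet hK htr Z).trans ?_
            refine le_trans ?_ le_self_add
            gcongr
        _ = ε := ENNReal.div_mul_cancel (by simp) hx
    choose Tj P hP using hex
    set A : (Σ _ : ι, (Fin m → ℤ)) → Set X :=
      fun i => (ψ i.1).source ∩ ψ i.1 ⁻¹' P i.1 i.2 with hAdef
    set T' : Finset (Σ _ : ι, (Fin m → ℤ)) := T.sigma fun j => Tj j with hT'
    have hT1 : ∀ i ∈ T', i.1 ∈ T := fun i hi => (Finset.mem_sigma.1 hi).1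
    have hAm : ∀ i ∈ T', MeasurableSet (A i) := fun i hi =>
      (ψ i.1).symm.measurableSet_target_inter_preimage ((hP i.1 (hT1 i hi)).1 i.2)
    have hAcov : ⋃ i ∈ T', A i = univ := by
      refine eq_univ_of_forall fun q => ?_
      obtain ⟨j, hj, hqs, hqB⟩ := hcov q
      obtain ⟨k, hk, hqP⟩ := mem_iUnion₂.1 ((hP j hj).2.1 hqB)
      exact mem_iUnion₂.2 ⟨⟨j, k⟩, Finset.mem_sigma.2 ⟨hj, hk⟩, hqs, hqP⟩
    -- Cubes from different charts overlap. Disjoint pieces make the step function equal to a single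
    -- constant on each; passing back from a piece to its full cube only enlarges the error
    -- integral.
    obtain ⟨A', hA'm, hA'A, hA'd, hA'cov⟩ := exists_disjoint_refinement T' hAm
    obtain ⟨V, hV, hVc⟩ := exists_finiteDimensional_indicator (μ := riemVolume h) T' hA'm
    refine ⟨V, hV, fun u hu => ?_⟩
    obtain ⟨Z, hZ, hZC⟩ := exists_isWeakGradient_of_sobolevNorm_lt (hlt u hu)
    have hc : ∀ j, ∃ c : (Fin m → ℤ) → ℝ, j ∈ T →
        ∑ k ∈ Tj j, ∫⁻ x in P j k ∩ (ψ j).target, volumeDensity h (ψ j) x *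
            ENNReal.ofReal ((u ((ψ j).symm x) - c k) ^ 2) ≤
              ENNReal.ofReal (η ^ 2) / (T.card + 1) := by
      intro j
      by_cases hj : j ∈ T
      · obtain ⟨c, hc⟩ := (hP j hj).2.2.2 hZ (le_add_self.trans hZC)
        exact ⟨c, fun _ => hc⟩
      · exact ⟨0, fun h' => absurd h' hj⟩
    choose c hc using hc
    obtain ⟨v, hvV, hv⟩ := hVc fun i => c i.1 i.2
    refine ⟨v, hvV, Lp.norm_sub_le_of_lintegral_sq_le u v hη.le ?_⟩
    have hvA : ∀ i ∈ T', ∀ q ∈ A' i,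
        ∑ i ∈ T', (A' i).indicator (fun _ => c i.1 i.2) q = c i.1 i.2 := by
      intro i hi q hq
      rw [Finset.sum_eq_single_of_mem i hi, indicator_of_mem hq]
      intro i' hi' hne
      exact indicator_of_notMem (Set.disjoint_right.1 (hA'd hi' hi hne) hq) _
    calc ∫⁻ q, ENNReal.ofReal ((u q - v q) ^ 2) ∂riemVolume h
        = ∫⁻ q, ENNReal.ofReal
            ((u q - ∑ i ∈ T', (A' i).indicator (fun _ => c i.1 i.2) q) ^ 2) ∂riemVolume h := by
          refine lintegral_congr_ae ?_
          filter_upwards [hv] with q hq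
          rw [hq]
      _ ≤ ∑ i ∈ T', ∫⁻ q in A' i, ENNReal.ofReal
            ((u q - ∑ i ∈ T', (A' i).indicator (fun _ => c i.1 i.2) q) ^ 2)
              ∂chartVolume h (ψ i.1) := by
          rw [← lintegral_finsetSum_measure]
          refine lintegral_mono' (riemVolume_le_sum T' h (fun i => ψ i.1)
            (fun i hi => (hb i.1 (hT1 i hi)).mem_maximalAtlas) hA'm
            (fun i hi => (hA'A i hi).trans inter_subset_left) (hA'cov.trans hAcov)) le_rfl
      _ ≤ ∑ i ∈ T', ∫⁻ q in A i, ENNReal.ofReal ((u q - c i.1 i.2) ^ 2)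
              ∂chartVolume h (ψ i.1) := by
          refine Finset.sum_le_sum fun i hi => ?_
          rw [setLIntegral_congr_fun (hA'm i hi) fun q hq => by
            simp only [hvA i hi q hq]; rfl]
          exact lintegral_mono_set (hA'A i hi)
      _ = ∑ i ∈ T', ∫⁻ x in P i.1 i.2 ∩ (ψ i.1).target, volumeDensity h (ψ i.1) x *
            ENNReal.ofReal ((u ((ψ i.1).symm x) - c i.1 i.2) ^ 2) := by
          refine Finset.sum_congr rfl fun i hi => ?_
          exact setLIntegral_chartVolume h (hb i.1 (hT1 i hi)).mem_maximalAtlas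
            ((hP i.1 (hT1 i hi)).1 i.2) _
      _ = ∑ j ∈ T, ∑ k ∈ Tj j, ∫⁻ x in P j k ∩ (ψ j).target, volumeDensity h (ψ j) x *
            ENNReal.ofReal ((u ((ψ j).symm x) - c j k) ^ 2) := Finset.sum_sigma _ _ _
      _ ≤ ∑ _j ∈ T, ENNReal.ofReal (η ^ 2) / (T.card + 1) :=
          Finset.sum_le_sum fun j hj => hc j hj
      _ = T.card * (ENNReal.ofReal (η ^ 2) / (T.card + 1)) := by
          rw [Finset.sum_const, nsmul_eq_mul]
      _ ≤ (T.card + 1) * (ENNReal.ofReal (η ^ 2) / (T.card + 1)) := by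
          gcongr
          exact le_self_add
      _ ≤ ENNReal.ofReal (η ^ 2) := ENNReal.mul_div_le

end LocalToGlobal

/-! ### Charts of the complement, block scaling and generic segments. -/

section AdmissibleBalls

/-- Charts of the open submanifold are restricted charts of M, and transition maps between
restrictions are restrictions of smooth transition maps. -/
theorem subtypeRestr_mem_maximalAtlas {m : ℕ} {M : Type*} [TopologicalSpace M]
    [ChartedSpace (Rm m) M] [IsManifold (𝓡 m) ∞ M] {s : TopologicalSpace.Opens M} (hs : Nonempty s)
    {φ : OpenPartialHomeomorph M (Rm m)} (hφ : φ ∈ IsManifold.maximalAtlas (𝓡 m) ∞ M) :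
    φ.subtypeRestr hs ∈ IsManifold.maximalAtlas (𝓡 m) ∞ s := by
  intro e' he'
  obtain ⟨x, rfl⟩ := TopologicalSpace.Opens.chart_eq hs he'
  have hx : chartAt (Rm m) (x : M) ∈ IsManifold.maximalAtlas (𝓡 m) ∞ M :=
    IsManifold.chart_mem_maximalAtlas _
  set G := contDiffGroupoid ∞ (𝓡 m)
  have hr : ∀ {e e' : OpenPartialHomeomorph M (Rm m)}, e ∈ IsManifold.maximalAtlas (𝓡 m) ∞ M →
      e' ∈ IsManifold.maximalAtlas (𝓡 m) ∞ M →
      (e.subtypeRestr hs).symm ≫ₕ e'.subtypeRestr hs ∈ G := by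
    intro e e' he he'
    exact G.mem_of_eqOnSource (closedUnderRestriction' (G.compatible_of_mem_maximalAtlas he he')
      (e.isOpen_inter_preimage_symm s.2)) (e.subtypeRestr_symm_trans_subtypeRestr hs e')
  exact ⟨hr hφ hx, hr hx hφ⟩

theorem mem_subtypeRestr_target_iff {X Y : Type*} [TopologicalSpace X] [TopologicalSpace Y]
    {s : TopologicalSpace.Opens X} (hs : Nonempty s) (φ : OpenPartialHomeomorph X Y) {y : Y} :
    y ∈ (φ.subtypeRestr hs).target ↔ y ∈ φ.target ∧ φ.symm y ∈ s := by
  constructor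
  · intro hy
    refine ⟨φ.subtypeRestr_target_subset hs hy, ?_⟩
    rw [← φ.subtypeRestr_symm_apply hs hy]
    exact Subtype.coe_prop _
  · rintro ⟨hy, hys⟩
    have := φ.map_subtype_source hs (x := ⟨φ.symm y, hys⟩) (φ.map_target hy)
    rwa [φ.right_inv hy] at this

variable {m : ℕ} {X : Type*} [TopologicalSpace X] [ChartedSpace (Rm m) X]

theorem dcoord_coordVec {φ : OpenPartialHomeomorph X (Rm m)}
    (hφ : φ ∈ IsManifold.maximalAtlas (𝓡 m) ∞ X) {y : Rm m} (hy : y ∈ φ.target) (k i : Fin m) :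
    dcoord φ k (φ.symm y) (coordVec φ y i) = if k = i then 1 else 0 := by
  have hc := mfderiv_comp y (I'' := 𝓡 m) (mdifferentiableAt_chart hφ (φ.map_target hy))
    (mdifferentiableAt_chart_symm hφ hy)
  have hid : φ ∘ φ.symm =ᶠ[𝓝 y] id := by
    filter_upwards [φ.open_target.mem_nhds hy] with z hz
    exact φ.right_inv hz
  rw [hid.mfderiv_eq, mfderiv_id] at hc
  have h1 := congrArg (fun L : Rm m →L[ℝ] Rm m => L (EuclideanSpace.single i (1 : ℝ)) k) hc
  have h2 : dcoord φ k (φ.symm y) (coordVec φ y i) =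
    (EuclideanSpace.single i (1 : ℝ) : Rm m) k := h1.symm
  rw [h2]
  simp

/-- The factors by which the coordinate vectors are rescaled: `a` in the `x`-directions, `1` in the
`y`-directions. -/
noncomputable def blockScale (m n : ℕ) (a : ℝ) (i : Fin m) : ℝ := if (i : ℕ) < m - n then a else 1

theorem prod_blockScale (m n : ℕ) (a : ℝ) : ∏ i : Fin m, blockScale m n a i = a ^ (m - n) := by
  simp only [blockScale]
  rw [Finset.prod_ite, Finset.prod_const, Finset.prod_const_one, mul_one]
  rw [Fin.card_filter_val_lt, min_eq_right (Nat.sub_le m n)]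

/-- Coordinate differentials are dual to coordinate vectors, so the entries of a block form depend
only on A and B. This allows metrics on M and on M \ N to be compared as matrices at the same
coordinate point. -/
theorem blockForm_smul_coordVec {n : ℕ} (hnm : n ≤ m) {X' : Type*} [TopologicalSpace X']
    [ChartedSpace (Rm m) X']
    {φ : OpenPartialHomeomorph X (Rm m)} {ψ : OpenPartialHomeomorph X' (Rm m)}
    (hφ : φ ∈ IsManifold.maximalAtlas (𝓡 m) ∞ X) (hψ : ψ ∈ IsManifold.maximalAtlas (𝓡 m) ∞ X')
    {y : Rm m} (hy : y ∈ φ.target) (hy' : y ∈ ψ.target) (a : ℝ)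
    (A : Matrix (Fin (m - n)) (Fin (m - n)) ℝ) (B : Matrix (Fin n) (Fin n) ℝ) (i j : Fin m) :
    blockForm hnm ψ (a ^ 2 • A) B (ψ.symm y) (coordVec ψ y i) (coordVec ψ y j) =
      blockScale m n a i * blockForm hnm φ A B (φ.symm y) (coordVec φ y i) (coordVec φ y j) *
        blockScale m n a j := by
  have hx : ∀ k, blockScale m n a (xIdx m n k) = a := fun k => by
    simp [blockScale, xIdx]
  have hyI : ∀ k, blockScale m n a (yIdx hnm k) = 1 := fun k => by
    simp [blockScale, yIdx]
  simp only [blockForm, dcoord_coordVec hφ hy, dcoord_coordVec hψ hy', mul_add, add_mul,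
    Finset.mul_sum, Finset.sum_mul]
  congr 1
  · refine Finset.sum_congr rfl fun k _ => Finset.sum_congr rfl fun l _ => ?_
    by_cases hk : xIdx m n k = i
    · by_cases hl : xIdx m n l = j
      · subst hk hl
        simp [hx]; ring
      · simp [hl]
    · simp [hk]
  · refine Finset.sum_congr rfl fun k _ => Finset.sum_congr rfl fun l _ => ?_
    by_cases hk : yIdx hnm k = i
    · by_cases hl : yIdx hnm l = j
      · subst hk hl
        simp [hyI]
      · simp [hl]
    · simp [hk]

theorem sqrt_det_scale {G G' : Matrix (Fin m) (Fin m) ℝ} {D : Fin m → ℝ}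
    (h : ∀ i j, G' i j = D i * G i j * D j) : √G'.det = |∏ i, D i| * √G.det := by
  have h1 : G' = Matrix.diagonal D * G * Matrix.diagonal D := by
    ext i j
    rw [Matrix.mul_diagonal, Matrix.diagonal_mul, h]
  rw [h1, Matrix.det_mul, Matrix.det_mul, Matrix.det_diagonal,
    show (∏ i, D i) * G.det * ∏ i, D i = (∏ i, D i) ^ 2 * G.det by ring,
    Real.sqrt_mul (sq_nonneg _), Real.sqrt_sq_eq_abs]

theorem ae_linearMap_ne_zero {L : Rm m →ₗ[ℝ] ℝ} (hL : L ≠ 0) : ∀ᵐ x : Rm m, L x ≠ 0 := by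
  have h := Measure.addHaar_submodule (volume : Measure (Rm m)) (LinearMap.ker L)
    (fun h => hL (LinearMap.ker_eq_top.1 h))
  rw [ae_iff]
  convert h using 2
  ext x; simp

variable [IsManifold (𝓡 m) ∞ X]

theorem continuousOn_sqrt_det_gram (h : SmoothMetric m X) {φ : OpenPartialHomeomorph X (Rm m)}
    (hφ : φ ∈ IsManifold.maximalAtlas (𝓡 m) ∞ X) :
    ContinuousOn (fun y => √(gram h φ y).det) φ.target :=
  Real.continuous_sqrt.comp_continuousOn
    ((Continuous.matrix_det continuous_id).comp_continuousOn (continuousOn_gram h hφ))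

theorem sqrt_det_gram_pos (h : SmoothMetric m X) {φ : OpenPartialHomeomorph X (Rm m)}
    (hφ : φ ∈ IsManifold.maximalAtlas (𝓡 m) ∞ X) {y : Rm m} (hy : y ∈ φ.target) :
    0 < √(gram h φ y).det :=
  Real.sqrt_pos.2 (gram_posDef h hφ hy).det_pos

theorem exists_trace_gram_le (h : SmoothMetric m X) {φ : OpenPartialHomeomorph X (Rm m)}
    (hφ : φ ∈ IsManifold.maximalAtlas (𝓡 m) ∞ X) {K : Set (Rm m)} (hK : IsCompact K)
    (hKt : K ⊆ φ.target) :
    ∃ C : ℝ, 0 ≤ C ∧ ∀ y ∈ K, ∑ i, gram h φ y i i ≤ C * √(gram h φ y).det := by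
  have htr : ContinuousOn (fun y => ∑ i, gram h φ y i i) φ.target := by
    refine continuousOn_finsetSum _ fun i _ => ?_
    exact (continuous_apply_apply i i).comp_continuousOn (continuousOn_gram h hφ)
  have hq : ContinuousOn (fun y => (∑ i, gram h φ y i i) / √(gram h φ y).det) K :=
    (htr.mono hKt).div ((continuousOn_sqrt_det_gram h hφ).mono hKt)
      fun y hy => (sqrt_det_gram_pos h hφ (hKt hy)).ne'
  obtain ⟨C, hC⟩ := hK.exists_bound_of_continuousOn hq
  refine ⟨max C 0, le_max_right _ _, fun y hy => ?_⟩
  have h1 := (le_abs_self _).trans (hC y hy)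
  rw [← div_le_iff₀ (sqrt_det_gram_pos h hφ (hKt hy))]
  exact h1.trans (le_max_left _ _)

theorem exists_sqrt_det_gram_le (h : SmoothMetric m X) {φ : OpenPartialHomeomorph X (Rm m)}
    (hφ : φ ∈ IsManifold.maximalAtlas (𝓡 m) ∞ X) {K : Set (Rm m)} (hK : IsCompact K)
    (hKt : K ⊆ φ.target) : ∃ C : ℝ, ∀ y ∈ K, √(gram h φ y).det ≤ C := by
  obtain ⟨C, hC⟩ := hK.exists_bound_of_continuousOn ((continuousOn_sqrt_det_gram h hφ).mono hKt)
  exact ⟨C, fun y hy => (le_abs_self _).trans (hC y hy)⟩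

theorem isAdmissibleBall_of_closedBall_subset (hm : 2 ≤ m) (h : SmoothMetric m X)
    {φ : OpenPartialHomeomorph X (Rm m)} (hφ : φ ∈ IsManifold.maximalAtlas (𝓡 m) ∞ X) {y : Rm m}
    {r : ℝ} (hr : 0 < r) (hB : Metric.closedBall y (2 * r) ⊆ φ.target) :
    IsAdmissibleBall h φ y r := by
  have hK := isCompact_closedBall y (2 * r)
  have hm' : (2 : ℝ) ≤ m := by exact_mod_cast hm
  -- The density is bounded here, so any exponent above 1 and m/2 serves; q = m is one.
  refine ⟨hφ, hr, ⟨m, by linarith, by linarith, ?_⟩, ?_, ?_⟩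
  · obtain ⟨C, hC⟩ := exists_sqrt_det_gram_le h hφ hK hB
    refine ne_top_of_le_ne_top ?_ (setLIntegral_mono' (g := fun _ => ENNReal.ofReal C ^ (m : ℝ))
      (hK.isClosed.measurableSet.inter φ.open_target.measurableSet) fun x hx => ?_)
    · rw [setLIntegral_const]
      refine ENNReal.mul_ne_top (by finiteness) ?_
      exact ((measure_mono inter_subset_left).trans_lt hK.measure_lt_top).ne
    · exact ENNReal.rpow_le_rpow (ENNReal.ofReal_le_ofReal (hC x hx.1)) (by positivity)
  · refine Eventually.of_forall fun x => Eventually.of_forall fun z hx hz t ht => ?_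
    exact hB ((convex_closedBall y (2 * r)).add_smul_sub_mem hx hz ht)
  · obtain ⟨C, hC0, hC⟩ := exists_trace_gram_le h hφ hK hB
    refine ⟨ENNReal.ofReal C, ENNReal.ofReal_ne_top, fun x hx => ?_⟩
    rw [volumeDensity, ← ENNReal.ofReal_mul hC0]
    exact ENNReal.ofReal_le_ofReal (hC x hx.1)

/-- Almost every segment misses a set on which two coordinates vanish. -/
theorem ae_ae_segment_ne_zero {i j : Fin m} (hij : i ≠ j) :
    ∀ᵐ x : Rm m, ∀ᵐ z : Rm m, ∀ t : ℝ, (x + t • (z - x)) i ≠ 0 ∨ (x + t • (z - x)) j ≠ 0 := by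
  have h1 := ae_linearMap_ne_zero (L := ((EuclideanSpace.proj i : Rm m →L[ℝ] ℝ) : Rm m →ₗ[ℝ] ℝ))
    (fun h => by
      have := LinearMap.congr_fun h (EuclideanSpace.single i 1)
      simp at this)
  filter_upwards [h1] with x hx
  have hx' : x i ≠ 0 := hx
  -- For almost every z the projections of x and z to the (i, j)-plane are linearly independent, and
  -- then the line through them misses the origin.
  have h2 := ae_linearMap_ne_zero (L := x i • ((EuclideanSpace.proj j : Rm m →L[ℝ] ℝ) : Rm m →ₗ[ℝ] ℝ)
      - x j • ((EuclideanSpace.proj i : Rm m →L[ℝ] ℝ) : Rm m →ₗ[ℝ] ℝ))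
    (fun h => by
      have := LinearMap.congr_fun h (EuclideanSpace.single j 1)
      simp [hij, hx'] at this)
  filter_upwards [h2] with z hz t
  have hz' : x i * z j - x j * z i ≠ 0 := by simpa using hz
  by_contra! hcon
  obtain ⟨e1, e2⟩ := hcon
  simp only [PiLp.add_apply, PiLp.smul_apply, PiLp.sub_apply, smul_eq_mul] at e1 e2
  have : t * (x i * z j - x j * z i) = 0 := by linear_combination x i * e2 - x j * e1
  rcases mul_eq_zero.1 this with h0 | h0
  · rw [h0] at e1; simp at e1; exact hx' e1
  · exact hz' h0

end AdmissibleBalls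

/-! ### Admissible balls around points of the submanifold. -/

section Slice

variable {m n : ℕ} {M : Type*} [TopologicalSpace M] [T2Space M]
  [ChartedSpace (Rm m) M]

theorem IsSliceChart.symm_mem_complOpens {N : Set M} {hN : IsCompact N}
    {φ : OpenPartialHomeomorph M (Rm m)} (hφ : IsSliceChart n N φ) {y : Rm m} (hy : y ∈ φ.target)
    (i : Fin (m - n)) (hi : y (xIdx m n i) ≠ 0) : φ.symm y ∈ complOpens hN := by
  intro hyN
  have := (hφ.2 _ (φ.map_target hy)).1 hyN i
  rw [φ.right_inv hy] at this
  exact hi this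

/-- The square is a² or 1, and each is a constant times a^(m-n) once a ≥ c > 0; for a² this uses m -
n ≥ 2. It yields the trace bound in slice charts. -/
theorem blockScale_sq_le {a : ℝ} {c : ℝ} (hc : 0 < c) (hac : c ≤ a) (hmn : n + 2 ≤ m)
    (i : Fin m) :
    blockScale m n a i ^ 2 ≤ ((c ^ (m - n - 2))⁻¹ + (c ^ (m - n))⁻¹) * |a| ^ (m - n) := by
  have ha : 0 < a := hc.trans_le hac
  rw [abs_of_pos ha, add_mul]
  have h1 : a ^ 2 ≤ (c ^ (m - n - 2))⁻¹ * a ^ (m - n) := by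
    have hd : m - n = (m - n - 2) + 2 := by omega
    have : a ^ (m - n) = a ^ (m - n - 2) * a ^ 2 := by rw [← pow_add, ← hd]
    rw [this, inv_mul_eq_div, le_div_iff₀ (by positivity), mul_comm]
    gcongr
  have h2 : 1 ≤ (c ^ (m - n))⁻¹ * a ^ (m - n) := by
    rw [inv_mul_eq_div, le_div_iff₀ (by positivity), one_mul]
    gcongr
  have h3 : 0 ≤ (c ^ (m - n - 2))⁻¹ * a ^ (m - n) := by positivity
  have h4 : 0 ≤ (c ^ (m - n))⁻¹ * a ^ (m - n) := by positivity
  unfold blockScale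
  split_ifs <;> [skip; rw [one_pow]] <;> linarith

variable [IsManifold (𝓡 m) ∞ M] [MeasurableSpace M] [BorelSpace M]

/-- In a slice chart in which the second metric arises from the first by scaling the `x`-block,
small balls are admissible. -/
theorem isAdmissibleBall_of_isSliceChart (hmn : n + 2 ≤ m) (g : SmoothMetric m M) {N : Set M}
    (hN : IsCompact N) (hX : Nonempty (complOpens hN)) (g' : SmoothMetric m (complOpens hN))
    {f : M → ℝ} {φ : OpenPartialHomeomorph M (Rm m)} (hφ : IsSliceChart n N φ)
    {g₁ : M → Matrix (Fin (m - n)) (Fin (m - n)) ℝ} {g₂ : M → Matrix (Fin n) (Fin n) ℝ}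
    (hg : ∀ q ∈ φ.source, ∀ v w : TangentSpace (𝓡 m) q,
      g.inner q v w = blockForm (Nat.le_of_add_right_le hmn) φ (g₁ q) (g₂ q) q v w)
    (hg' : ∀ q : complOpens hN, (q : M) ∈ φ.source → ∀ v w : TangentSpace (𝓡 m) q,
      g'.inner q v w = blockForm (Nat.le_of_add_right_le hmn) (fun x : complOpens hN => φ x)
        (f q ^ 2 • g₁ q) (g₂ q) q v w)
    {q : ℝ} (hq : 1 < q) (hmq : m < 2 * q)
    (hfq : ∫⁻ p, ENNReal.ofReal (|f p| ^ (m - n)) ^ q ∂riemVolume g ≠ ⊤)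
    {C₁ : ℝ} (hC₁ : 0 ≤ C₁)
    (hscale : ∀ p ∈ Nᶜ, ∀ i : Fin m, blockScale m n (f p) i ^ 2 ≤ C₁ * |f p| ^ (m - n))
    {y : Rm m} {r : ℝ} (hr : 0 < r) (hB : Metric.closedBall y (2 * r) ⊆ φ.target) :
    IsAdmissibleBall g' (φ.subtypeRestr hX) y r := by
  set ψ := φ.subtypeRestr hX with hψdef
  have hψ : ψ ∈ IsManifold.maximalAtlas (𝓡 m) ∞ (complOpens hN) :=
    subtypeRestr_mem_maximalAtlas hX hφ.1
  have hK := isCompact_closedBall y (2 * r)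
  have hgram : ∀ x ∈ ψ.target, ∀ i j, gram g' ψ x i j =
      blockScale m n (f (φ.symm x)) i * gram g φ x i j * blockScale m n (f (φ.symm x)) j := by
    intro x hx i j
    have hxφ := φ.subtypeRestr_target_subset hX hx
    have hsymm : ((ψ.symm x : complOpens hN) : M) = φ.symm x := φ.subtypeRestr_symm_apply hX hx
    have h1 := hg' (ψ.symm x) (by rw [hsymm]; exact φ.map_target hxφ) (coordVec ψ x i)
      (coordVec ψ x j)
    have h2 := hg (φ.symm x) (φ.map_target hxφ) (coordVec φ x i) (coordVec φ x j)
    have h3 := blockForm_smul_coordVec (Nat.le_of_add_right_le hmn) hφ.1 hψ hxφ hx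
      (f (φ.symm x)) (g₁ (φ.symm x)) (g₂ (φ.symm x)) i j
    rw [← h2] at h3
    rw [hsymm] at h1
    exact h1.trans h3
  have hdet : ∀ x ∈ ψ.target,
      √(gram g' ψ x).det = |f (φ.symm x)| ^ (m - n) * √(gram g φ x).det := by
    intro x hx
    rw [sqrt_det_scale (hgram x hx), prod_blockScale, abs_pow]
  have hBm : MeasurableSet (Metric.closedBall y (2 * r) ∩ ψ.target) :=
    hK.isClosed.measurableSet.inter ψ.open_target.measurableSet
  refine ⟨hψ, hr, ⟨q, hq, hmq, ?_⟩, ?_, ?_⟩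
  · obtain ⟨C, hC⟩ := exists_sqrt_det_gram_le g hφ.1 hK hB
    -- All but one of the q powers of the density of g are bounded on the compact ball. The
    -- remaining one turns Lebesgue measure into the Riemannian measure of g, to which the
    -- hypothesis on f refers.
    have hbound : ∀ x ∈ Metric.closedBall y (2 * r) ∩ ψ.target, volumeDensity g' ψ x ^ q ≤
        ENNReal.ofReal C ^ (q - 1) * (volumeDensity g φ x *
          ENNReal.ofReal (|f (φ.symm x)| ^ (m - n)) ^ q) := by
      intro x hx
      have e1 : volumeDensity g' ψ x =
          ENNReal.ofReal (|f (φ.symm x)| ^ (m - n)) * volumeDensity g φ x := by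
        rw [volumeDensity, volumeDensity, hdet x hx.2, ENNReal.ofReal_mul (by positivity)]
      have e2 : volumeDensity g φ x ≤ ENNReal.ofReal C := ENNReal.ofReal_le_ofReal (hC x hx.1)
      have e3 : volumeDensity g φ x ^ q ≤ ENNReal.ofReal C ^ (q - 1) * volumeDensity g φ x := by
        calc volumeDensity g φ x ^ q = volumeDensity g φ x ^ ((q - 1) + 1) := by ring_nf
          _ = volumeDensity g φ x ^ (q - 1) * volumeDensity g φ x := by
            rw [ENNReal.rpow_add_of_nonneg _ _ (by linarith) zero_le_one, ENNReal.rpow_one]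
          _ ≤ _ := by gcongr
      rw [e1, ENNReal.mul_rpow_of_nonneg _ _ (by linarith)]
      calc _ ≤ ENNReal.ofReal (|f (φ.symm x)| ^ (m - n)) ^ q *
            (ENNReal.ofReal C ^ (q - 1) * volumeDensity g φ x) := by gcongr
        _ = _ := by ring
    refine ne_top_of_le_ne_top ?_ (setLIntegral_mono' hBm hbound)
    have hCtop : ENNReal.ofReal C ^ (q - 1) ≠ ⊤ :=
      ENNReal.rpow_ne_top_of_nonneg (by linarith) ENNReal.ofReal_ne_top
    rw [lintegral_const_mul' _ _ hCtop]
    refine ENNReal.mul_ne_top hCtop (ne_top_of_le_ne_top hfq ?_)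
    calc ∫⁻ x in Metric.closedBall y (2 * r) ∩ ψ.target, volumeDensity g φ x *
          ENNReal.ofReal (|f (φ.symm x)| ^ (m - n)) ^ q
        ≤ ∫⁻ x in Metric.closedBall y (2 * r) ∩ φ.target, volumeDensity g φ x *
          ENNReal.ofReal (|f (φ.symm x)| ^ (m - n)) ^ q :=
          lintegral_mono_set (inter_subset_inter_right _ (φ.subtypeRestr_target_subset hX))
      _ = ∫⁻ p in φ.source ∩ φ ⁻¹' Metric.closedBall y (2 * r),
          ENNReal.ofReal (|f p| ^ (m - n)) ^ q ∂chartVolume g φ :=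
          (setLIntegral_chartVolume g hφ.1 hK.isClosed.measurableSet
            fun p => ENNReal.ofReal (|f p| ^ (m - n)) ^ q).symm
      _ ≤ _ := (setLIntegral_le_lintegral _ _).trans
          (lintegral_mono' (chartVolume_le_riemVolume g hφ.1) le_rfl)
  · have hij : xIdx m n ⟨0, by omega⟩ ≠ xIdx m n ⟨1, by omega⟩ := by
      simp [xIdx, Fin.ext_iff]
    filter_upwards [ae_ae_segment_ne_zero hij] with x hx
    filter_upwards [hx] with z hz hxB hzB t ht
    have hmem := hB ((convex_closedBall y (2 * r)).add_smul_sub_mem hxB hzB ht)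
    rw [mem_subtypeRestr_target_iff]
    refine ⟨hmem, ?_⟩
    rcases hz t with h0 | h0
    · exact hφ.symm_mem_complOpens hmem _ h0
    · exact hφ.symm_mem_complOpens hmem _ h0
  · obtain ⟨C, hC0, hC⟩ := exists_trace_gram_le g hφ.1 hK hB
    refine ⟨ENNReal.ofReal (C₁ * C), ENNReal.ofReal_ne_top, fun x hx => ?_⟩
    have hxφ := φ.subtypeRestr_target_subset hX hx.2
    have hxN : φ.symm x ∈ Nᶜ := ((mem_subtypeRestr_target_iff hX φ).1 hx.2).2
    rw [volumeDensity, ← ENNReal.ofReal_mul (by positivity), hdet x hx.2]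
    refine ENNReal.ofReal_le_ofReal ?_
    calc ∑ i, gram g' ψ x i i
        = ∑ i, blockScale m n (f (φ.symm x)) i ^ 2 * gram g φ x i i :=
          Finset.sum_congr rfl fun i _ => by rw [hgram x hx.2]; ring
      _ ≤ ∑ i, (C₁ * |f (φ.symm x)| ^ (m - n)) * gram g φ x i i := by
          refine Finset.sum_le_sum fun i _ => ?_
          exact mul_le_mul_of_nonneg_right (hscale _ hxN i) (gram_posDef g hφ.1 hxφ).diag_pos.le
      _ = (C₁ * |f (φ.symm x)| ^ (m - n)) * ∑ i, gram g φ x i i := by rw [Finset.mul_sum]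
      _ ≤ (C₁ * |f (φ.symm x)| ^ (m - n)) * (C * √(gram g φ x).det) := by
          gcongr
          exact hC x hx.1
      _ = _ := by ring

end Slice

/-! ### The main theorem. -/

theorem MeasureTheory.MemLp.lintegral_abs_pow_rpow_ne_top {α : Type*} [MeasurableSpace α]
    {μ : Measure α} {f : α → ℝ} {p : ℝ} (hp : 0 < p) (hf : MemLp f (ENNReal.ofReal p) μ) {k : ℕ}
    {q : ℝ} (hkq : k * q = p) :
    ∫⁻ x, ENNReal.ofReal (|f x| ^ k) ^ q ∂μ ≠ ⊤ := by
  have h := lintegral_rpow_enorm_lt_top_of_eLpNorm_lt_top (f := f) (p := ENNReal.ofReal p)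
    (by simpa using hp) ENNReal.ofReal_ne_top hf.2
  rw [ENNReal.toReal_ofReal hp.le] at h
  refine ne_of_eq_of_ne (lintegral_congr fun x => ?_) h.ne
  rw [ENNReal.ofReal_pow (abs_nonneg _), ← Real.norm_eq_abs, ofReal_norm, ← ENNReal.rpow_natCast,
    ← ENNReal.rpow_mul, hkq]

theorem theorem1p1 {m n : ℕ} (hmn : n + 2 ≤ m)
    {M : Type*} [TopologicalSpace M] [T2Space M] [CompactSpace M]
    [ChartedSpace (Rm m) M] [IsManifold (𝓡 m) ∞ M] [MeasurableSpace M] [BorelSpace M]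
    (g : SmoothMetric m M)
    (N : Set M) (hN : IsCompact N) (hNsub : IsSubmanifold (m := m) n N)
    (g' : SmoothMetric m (complOpens hN))
    (f : M → ℝ) (hf : ContMDiffOn (𝓡 m) 𝓘(ℝ, ℝ) ∞ f Nᶜ)
    -- near every point of `N` there are coordinates `(x, y)`, with `N = {x = 0}`, in which
    -- `g = diag(g₁, g₂)` and, off `N`, `g' = diag(f² g₁, g₂)`
    (hdiag : ∀ p ∈ N, ∃ φ : OpenPartialHomeomorph M (Rm m), p ∈ φ.source ∧
      IsSliceChart n N φ ∧
      ∃ (g₁ : M → Matrix (Fin (m - n)) (Fin (m - n)) ℝ) (g₂ : M → Matrix (Fin n) (Fin n) ℝ),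
        (∀ q ∈ φ.source, ∀ v w : TangentSpace (𝓡 m) q,
          g.inner q v w =
            blockForm (Nat.le_of_add_right_le hmn) φ (g₁ q) (g₂ q) q v w) ∧
        (∀ q : complOpens hN, (q : M) ∈ φ.source → ∀ v w : TangentSpace (𝓡 m) q,
          g'.inner q v w =
            blockForm (Nat.le_of_add_right_le hmn) (fun x : complOpens hN => φ x)
              (f q ^ 2 • g₁ q) (g₂ q) q v w))
    (hf₂ : m = 2 → ∃ ε : ℝ, 0 < ε ∧ MemLp f (ENNReal.ofReal (2 + ε)) (riemVolume g))
    (hf₃ : 3 ≤ m → (∃ c : ℝ, 0 < c ∧ ∀ q ∈ Nᶜ, c ≤ f q) ∧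
      ∃ ε : ℝ, 0 < ε ∧
        MemLp f (ENNReal.ofReal ((m : ℝ) * ((m : ℝ) - n) / 2 + ε)) (riemVolume g)) :
    SobolevCompactlyIncluded g' := by
  have hm2 : 2 ≤ m := by omega
  -- Restricting charts to the complement needs a point in it; if there is none, the empty family of
  -- balls covers.
  rcases isEmpty_or_nonempty (complOpens hN) with hX | hX
  · exact sobolevCompactlyIncluded_of_admissibleBalls (by omega) g' (ι := Empty) ∅
      (fun j => j.elim) (fun j => j.elim) (fun j => j.elim) (by simp) (fun q => isEmptyElim q)
  have hcast : ((m - n : ℕ) : ℝ) = (m : ℝ) - n := by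
    rw [Nat.cast_sub (by omega)]
  have hmn' : (2 : ℝ) ≤ (m : ℝ) - n := by
    rw [← hcast]
    exact_mod_cast (by omega : 2 ≤ m - n)
  obtain ⟨q, hq, hmq, hfq⟩ : ∃ q : ℝ, 1 < q ∧ m < 2 * q ∧
      ∫⁻ p, ENNReal.ofReal (|f p| ^ (m - n)) ^ q ∂riemVolume g ≠ ⊤ := by
    rcases hm2.eq_or_lt with h2 | h3
    · obtain ⟨ε, hε, hfε⟩ := hf₂ h2.symm
      have hn : n = 0 := by omega
      refine ⟨1 + ε / 2, by linarith, ?_, ?_⟩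
      · rw [← h2]; push_cast; linarith
      · refine hfε.lintegral_abs_pow_rpow_ne_top (by linarith) ?_
        rw [← h2, hn]; push_cast; ring
    · obtain ⟨-, ε, hε, hfε⟩ := hf₃ h3
      have hm3 : (3 : ℝ) ≤ m := by exact_mod_cast h3
      have hpos : 0 < ε / ((m : ℝ) - n) := by positivity
      -- This q solves (m - n) q = m(m - n)/2 + ε, the exponent for f; it exceeds m/2 just because ε
      -- > 0.
      refine ⟨m / 2 + ε / ((m : ℝ) - n), by linarith, by linarith, ?_⟩
      refine hfε.lintegral_abs_pow_rpow_ne_top (by positivity) ?_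
      rw [hcast]
      have : (m : ℝ) - n ≠ 0 := by linarith
      field_simp
  obtain ⟨C₁, hC₁, hscale⟩ : ∃ C₁ : ℝ, 0 ≤ C₁ ∧
      ∀ p ∈ Nᶜ, ∀ i : Fin m, blockScale m n (f p) i ^ 2 ≤ C₁ * |f p| ^ (m - n) := by
    rcases hm2.eq_or_lt with h2 | h3
    · refine ⟨1, zero_le_one, fun p _ i => ?_⟩
      -- For m = 2 there are no y-directions: every coordinate vector is scaled by f, and the bound
      -- is an equality with no lower bound on f.
      have hk : m - n = 2 := by omega
      have hi : (i : ℕ) < m - n := by omega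
      rw [blockScale, if_pos hi, hk, sq_abs, one_mul]
    · obtain ⟨⟨c, hc, hcf⟩, -⟩ := hf₃ h3
      exact ⟨_, by positivity, fun p hp i => blockScale_sq_le hc (hcf p hp) hmn i⟩
  -- The neighbourhoods are taken at all points of M, those of N included, because M is compact
  -- while M \ N need not be. At a point of N the centre of the ball lies outside the target of the
  -- restricted chart.
  have hloc : ∀ p : M, ∃ O ∈ 𝓝 p, ∃ (ψ : OpenPartialHomeomorph (complOpens hN) (Rm m))
      (y : Rm m) (r : ℝ), IsAdmissibleBall g' ψ y r ∧
      ∀ x : complOpens hN, (x : M) ∈ O → x ∈ ψ.source ∧ ψ x ∈ Metric.closedBall y r := by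
    have hnhds : ∀ {φ : OpenPartialHomeomorph M (Rm m)} {p : M}, p ∈ φ.source → ∀ {r : ℝ}, 0 < r →
        φ.source ∩ φ ⁻¹' Metric.closedBall (φ p) r ∈ 𝓝 p := by
      intro φ p hp r hr
      exact inter_mem (φ.open_source.mem_nhds hp)
        ((φ.continuousAt hp).preimage_mem_nhds (Metric.closedBall_mem_nhds _ hr))
    have hball : ∀ {s : Set (Rm m)} {y : Rm m}, s ∈ 𝓝 y →
        ∃ r : ℝ, 0 < r ∧ Metric.closedBall y (2 * r) ⊆ s := by
      intro s y hs
      obtain ⟨ε, hε, hsub⟩ := Metric.nhds_basis_closedBall.mem_iff.1 hs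
      exact ⟨ε / 2, by positivity, by rwa [mul_div_cancel₀ _ two_ne_zero]⟩
    intro p
    by_cases hp : p ∈ N
    · obtain ⟨φ, hpφ, hφ, g₁, g₂, hg, hg'⟩ := hdiag p hp
      obtain ⟨r, hr, hsub⟩ := hball (φ.open_target.mem_nhds (φ.map_source hpφ))
      refine ⟨_, hnhds hpφ hr, φ.subtypeRestr hX, φ p, r,
        isAdmissibleBall_of_isSliceChart hmn g hN hX g' hφ hg hg' hq hmq hfq hC₁ hscale hr hsub,
        fun x hx => ⟨?_, hx.2⟩⟩
      rw [φ.subtypeRestr_source]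
      exact hx.1
    · set φ := chartAt (Rm m) p with hφdef
      have hpφ : p ∈ φ.source := mem_chart_source _ p
      have hφ : φ ∈ IsManifold.maximalAtlas (𝓡 m) ∞ M := IsManifold.chart_mem_maximalAtlas p
      have hpt : φ p ∈ (φ.subtypeRestr hX).target := by
        rw [mem_subtypeRestr_target_iff, φ.left_inv hpφ]
        exact ⟨φ.map_source hpφ, hp⟩
      obtain ⟨r, hr, hsub⟩ := hball ((φ.subtypeRestr hX).open_target.mem_nhds hpt)
      refine ⟨_, hnhds hpφ hr, φ.subtypeRestr hX, φ p, r,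
        isAdmissibleBall_of_closedBall_subset hm2 g' (subtypeRestr_mem_maximalAtlas hX hφ) hr hsub,
        fun x hx => ⟨?_, hx.2⟩⟩
      rw [φ.subtypeRestr_source]
      exact hx.1
  choose O hO ψ y r hadm hOψ using hloc
  obtain ⟨T, -, hT⟩ := isCompact_univ.elim_nhds_subcover O fun p _ => hO p
  refine sobolevCompactlyIncluded_of_admissibleBalls (by omega) g' T ψ y r
    (fun p _ => hadm p) fun x => ?_
  obtain ⟨p, hpT, hxp⟩ := mem_iUnion₂.1 (hT (mem_univ (x : M)))
  exact ⟨p, hpT, hOψ p x hxp⟩
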